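/- Let $\mathbb F$ be a field of characteristic $0$. The tetrahedron algebra $\boxtimes$ is the Lie algebra over $\mathbb F$ with generators $x_{ij}$ ($i,j\in\{0,1,2,3\}$, $i\neq j$) and relations $x_{ij}+x_{ji}=0$ for distinct $i,j$; $[x_{hi},x_{ij}]=2x_{hi}+2x_{ij}$ for mutually distinct $h,i,j$; and $[x_{hi},[x_{hi},[x_{hi},x_{jk}]]]=4[x_{hi},x_{jk}]$ for mutually distinct $h,i,j,k$. An element $\xi\in\boxtimes$ is called $x_{ij}$-like if $[x_{ij},\xi]=0$ and $[x_{hk},[x_{hk},[x_{hk},\xi]]]=4[x_{hk},\xi]$, where $h,i,j,k$ are mutually distinct. Let $\mathcal O$ be the Lie subalgebra of $\boxtimes$ generated by $x_{12}$ and $x_{03}$. Define sequences $(a_n)_{n\ge0}$ and $(b_n)_{n\ge0}$ in $\mathcal O$ by $a_0=x_{12}$, $b_0=x_{03}$ and, for $j\ge1$, \[ a_{2j-1}=[b_0,a_{2j-2}],\quad a_{2j}=[a_0,a_{2j-1}],\quad b_{2j-1}=[a_0,b_{2j-2}],\quad b_{2j}=[b_0,b_{2j-1}], \] and put, for $i\ge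 0$, with $a_{-1}:=0$ and $b_{-2}:=0$, \[ \boldsymbol x_i=a_{2i}+4b_{2i-2},\quad \boldsymbol y_i=a_{2i+1}+2a_{2i}+4a_{2i-1}-2b_{2i},\quad \boldsymbol z_i=a_{2i+1}+2a_{2i}-4a_{2i-1}+2b_{2i}. \] **Theorem.** The elements $\boldsymbol x_i,\boldsymbol y_i,\boldsymbol z_i$ ($i\ge0$) form a basis of the $\mathbb F$-vector space $\mathcal O$; each $\boldsymbol x_i$ is $x_{12}$-like, each $\boldsymbol y_i$ is $x_{23}$-like and each $\boldsymbol z_i$ is $x_{31}$-like. Moreover $x_{12}=\boldsymbol x_0$ and $x_{03}=(\boldsymbol z_0-\boldsymbol y_0)/4$. The Lie bracket acts on this basis as follows. For all $i,j\ge0$, \[ [\boldsymbol x_i,\boldsymbol x_j]=[\boldsymbol y_i,\boldsymbol y_j]=[\boldsymbol z_i,\boldsymbol z_j]=0. \] Furthermore \begin{align*} [\boldsymbol x_0,\boldsymbol y_0]&=\boldsymbol x_1+2\boldsymbol y_0-4\boldsymbol x_0,\\ [\boldsymbol x_1,\boldsymbol y_0]&=\boldsymbol x_2+2\boldsymbol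 y_1-4\boldsymbol x_1-8\boldsymbol y_0+16\boldsymbol x_0,\\ [\boldsymbol x_i,\boldsymbol y_0]&=\boldsymbol x_{i+1}+2\boldsymbol y_i-4\boldsymbol x_i-8\boldsymbol y_{i-1} && (i\ge2),\\ [\boldsymbol x_i,\boldsymbol y_j]&=\boldsymbol x_{i+j+1}+2\boldsymbol y_{i+j} && (i=0,1;\ j\ge1),\\ [\boldsymbol x_i,\boldsymbol y_j]&=\boldsymbol x_{i+j+1}+2\boldsymbol y_{i+j}-16\boldsymbol x_{i+j-1}-32\boldsymbol y_{i+j-2} && (i\ge2,\ j\ge1), \end{align*} \begin{align*} [\boldsymbol x_0,\boldsymbol z_0]&=\boldsymbol x_1-2\boldsymbol z_0+4\boldsymbol x_0,\\ [\boldsymbol x_1,\boldsymbol z_0]&=\boldsymbol x_2-2\boldsymbol z_1+4\boldsymbol x_1-8\boldsymbol z_0+16\boldsymbol x_0,\\ [\boldsymbol x_i,\boldsymbol z_0]&=\boldsymbol x_{i+1}-2\boldsymbol z_i+4\boldsymbol x_i-8\boldsymbol z_{i-1} && (i\ge2),\\ [\boldsymbol x_i,\boldsymbol z_j]&=\boldsymbol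 x_{i+j+1}-2\boldsymbol z_{i+j} && (i=0,1;\ j\ge1),\\ [\boldsymbol x_i,\boldsymbol z_j]&=\boldsymbol x_{i+j+1}-2\boldsymbol z_{i+j}-16\boldsymbol x_{i+j-1}+32\boldsymbol z_{i+j-2} && (i\ge2,\ j\ge1), \end{align*} \begin{align*} [\boldsymbol y_0,\boldsymbol z_0]&=\boldsymbol z_1-\boldsymbol y_1,\\ [\boldsymbol y_i,\boldsymbol z_0]&=\boldsymbol z_{i+1}-\boldsymbol y_{i+1}+4\boldsymbol z_i-4\boldsymbol y_i && (i\ge1),\\ [\boldsymbol y_0,\boldsymbol z_j]&=\boldsymbol z_{j+1}-\boldsymbol y_{j+1}-4\boldsymbol z_j+4\boldsymbol y_j && (j\ge1),\\ [\boldsymbol y_i,\boldsymbol z_j]&=\boldsymbol z_{i+j+1}-\boldsymbol y_{i+j+1}-16\boldsymbol z_{i+j-1}+16\boldsymbol y_{i+j-1} && (i,j\ge1). \end{align*} -/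

import Mathlib

noncomputable section

namespace Tetrahedron

/-- Labels of the twelve standard generators: ordered pairs of distinct elements of
`{0, 1, 2, 3}`. -/
abbrev Gen : Type := {p : Fin 4 × Fin 4 // p.1 ≠ p.2}

/-- The free generator labelled by the pair `(i, j)`, `i ≠ j`. -/
def freeGen (F : Type*) [Field F] (i j : Fin 4) (hij : i ≠ j) : FreeLieAlgebra F Gen :=
  FreeLieAlgebra.of F ⟨(i, j), hij⟩

/-- The defining relators of the tetrahedron algebra, as elements of the free Lie algebra on the
twelve generators. -/
inductive IsRelator (F : Type*) [Field F] : FreeLieAlgebra F Gen → Prop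
  | skew (i j : Fin 4) (hij : i ≠ j) :
      IsRelator F (freeGen F i j hij + freeGen F j i hij.symm)
  | triangle (h i j : Fin 4) (hi : h ≠ i) (hj : h ≠ j) (ij : i ≠ j) :
      IsRelator F (⁅freeGen F h i hi, freeGen F i j ij⁆ -
        ((2 : F) • freeGen F h i hi + (2 : F) • freeGen F i j ij))
  | dolanGrady (h i j k : Fin 4) (hi : h ≠ i) (hj : h ≠ j) (hk : h ≠ k) (ij : i ≠ j)
      (ik : i ≠ k) (jk : j ≠ k) :
      IsRelator F (⁅freeGen F h i hi, ⁅freeGen F h i hi, ⁅freeGen F h i hi, freeGen F j k jk⁆⁆⁆ -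
        (4 : F) • ⁅freeGen F h i hi, freeGen F j k jk⁆)

/-- The ideal of the free Lie algebra generated by the relators. -/
def relIdeal (F : Type*) [Field F] : LieIdeal F (FreeLieAlgebra F Gen) :=
  LieSubmodule.lieSpan F (FreeLieAlgebra F Gen) {r | IsRelator F r}

/-- The tetrahedron algebra over `F`. -/
def Tet (F : Type*) [Field F] : Type _ := FreeLieAlgebra F Gen ⧸ relIdeal F

instance instLieRingTet (F : Type*) [Field F] : LieRing (Tet F) :=
  inferInstanceAs (LieRing (FreeLieAlgebra F Gen ⧸ relIdeal F))

instance instLieAlgebraTet (F : Type*) [Field F] : LieAlgebra F (Tet F) :=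
  inferInstanceAs (LieAlgebra F (FreeLieAlgebra F Gen ⧸ relIdeal F))

/-- The standard generator `x_{ij}` of the tetrahedron algebra. -/
def gen (F : Type*) [Field F] (i j : Fin 4) (hij : i ≠ j := by decide) : Tet F :=
  LieSubmodule.Quotient.mk (N := relIdeal F) (freeGen F i j hij)

/-- `ξ` is `x_{ij}`-like: it commutes with `x_{ij}`, and satisfies the Dolan-Grady relation with
`x_{hk}` whenever `h, i, j, k` are mutually distinct. -/
def IsLike (F : Type*) [Field F] (i j : Fin 4) (hij : i ≠ j) (ξ : Tet F) : Prop :=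
  ⁅gen F i j hij, ξ⁆ = 0 ∧
  ∀ (h k : Fin 4) (hk : h ≠ k), h ≠ i → h ≠ j → k ≠ i → k ≠ j →
    ⁅gen F h k hk, ⁅gen F h k hk, ⁅gen F h k hk, ξ⁆⁆⁆ = (4 : F) • ⁅gen F h k hk, ξ⁆

/-- The Onsager subalgebra generated by `x_{12}` and `x_{03}`. -/
def onsager (F : Type*) [Field F] : LieSubalgebra F (Tet F) :=
  LieSubalgebra.lieSpan F (Tet F) {gen F 1 2, gen F 0 3}

/-- `a_0 = x_{12}, a_1 = [x_{03}, a_0], a_2 = [x_{12}, a_1], a_3 = [x_{03}, a_2], …` -/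
def seqA (F : Type*) [Field F] : ℕ → Tet F
  | 0 => gen F 1 2
  | n + 1 => if Even n then ⁅gen F 0 3, seqA F n⁆ else ⁅gen F 1 2, seqA F n⁆

/-- `b_0 = x_{03}, b_1 = [x_{12}, b_0], b_2 = [x_{03}, b_1], b_3 = [x_{12}, b_2], …` -/
def seqB (F : Type*) [Field F] : ℕ → Tet F
  | 0 => gen F 0 3
  | n + 1 => if Even n then ⁅gen F 1 2, seqB F n⁆ else ⁅gen F 0 3, seqB F n⁆

/-- `x_i = a_{2i} + 4 b_{2i-2}`, with `b_{-2} = 0`. -/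
def vecX (F : Type*) [Field F] : ℕ → Tet F
  | 0 => seqA F 0
  | i + 1 => seqA F (2 * (i + 1)) + (4 : F) • seqB F (2 * i)

/-- `y_i = a_{2i+1} + 2 a_{2i} + 4 a_{2i-1} - 2 b_{2i}`, with `a_{-1} = 0`. -/
def vecY (F : Type*) [Field F] : ℕ → Tet F
  | 0 => seqA F 1 + (2 : F) • seqA F 0 - (2 : F) • seqB F 0
  | i + 1 => seqA F (2 * (i + 1) + 1) + (2 : F) • seqA F (2 * (i + 1)) +
      (4 : F) • seqA F (2 * i + 1) - (2 : F) • seqB F (2 * (i + 1))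

/-- `z_i = a_{2i+1} + 2 a_{2i} - 4 a_{2i-1} + 2 b_{2i}`, with `a_{-1} = 0`. -/
def vecZ (F : Type*) [Field F] : ℕ → Tet F
  | 0 => seqA F 1 + (2 : F) • seqA F 0 + (2 : F) • seqB F 0
  | i + 1 => seqA F (2 * (i + 1) + 1) + (2 : F) • seqA F (2 * (i + 1)) -
      (4 : F) • seqA F (2 * i + 1) + (2 : F) • seqB F (2 * (i + 1))

end Tetrahedron

end

/-! Everything is checked on 2×2 matrices. Attach to the vertices 0, 1, 2, 3 the points -s, -1, 1, s
of the projective line over K = Frac F[s, s⁻¹], and send x_ij to the traceless matrix with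
eigenvalue -1 at point i and 1 at point j. The defining relations hold, which gives `toModel`.

This representation is faithful on 𝒪. Onsager's argument (`dolanGrady_lieSpan`) turns the
Dolan-Grady relations into a spanning set A_m, G_m = [A_m, A_0]/2 (m ∈ ℤ) with G_{-m} = -G_m. Their
images are antidiagonal with entries s^m, s^{-m}, and diagonal with entries ±(s^m - s^{-m})/2, so no
nonzero combination dies (`eq_zero_of_toModel_eq_zero`).

Put w = 2(s + s⁻¹). The vectors x_i, y_i, z_i map to multiples of the images of x_12, x_23, x_31
(`toModel_vecX`, `toModel_vecY`, `toModel_vecZ`), with coefficients running through F-bases of F[w],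
(w - 4)F[w], (w + 4)F[w]. By the triangle relation each entry of the bracket table is then a
polynomial identity in w. Independence holds because w is transcendental and the three face matrices
are independent over K; spanning holds because the table makes the span stable under x_12 and x_03.

Likeness also involves generators outside 𝒪. If the edge ij meets both 12 and 03 in one vertex, then
𝒪 + F x_ij is stable under ad x_ij. For the edges needed, the representation stays faithful there,
since x_ij has a matrix entry 2/(s - c) with c ≠ 0, which is not a Laurent polynomial
(`eq_zero_of_mem_onsager_sup`). -/

noncomputable section

namespace Tetrahedron

open LaurentPolynomial

attribute [local instance 100] LieRing.ofAssociativeRing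

/-! ### Onsager's theorem: a spanning set from the Dolan-Grady relations. -/

section Onsager

variable {F L : Type*} [Field F] [CharZero F] [LieRing L] [LieAlgebra F L]

/-- One more unit-step bracket of an Onsager sequence, from three consecutive ones. -/
theorem onsager_step {g m₂ m₁ a₀ a₁ a₂ a₃ a₄ : L}
    (r₁ : ⁅g, m₁⁆ = a₀ - m₂) (r₂ : ⁅g, a₀⁆ = a₁ - m₁) (r₃ : ⁅g, a₁⁆ = a₂ - a₀)
    (r₄ : ⁅g, a₂⁆ = a₃ - a₁) (r₅ : ⁅g, a₃⁆ = a₄ - a₂)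
    (h₀ : ⁅a₀, m₁⁆ = (2 : F) • g) (h₁ : ⁅a₁, a₀⁆ = (2 : F) • g)
    (h₂ : ⁅a₂, a₁⁆ = (2 : F) • g) : ⁅a₃, a₂⁆ = (2 : F) • g := by
  have sk : ∀ u v : L, ⁅u, v⁆ = -⁅v, u⁆ := fun u v => (lie_skew u v).symm
  have sk₀ : ⁅m₁, a₀⁆ = -(2 : F) • g := by rw [sk, h₀, neg_smul]
  have sk₁ : ⁅a₀, a₁⁆ = -(2 : F) • g := by rw [sk, h₁, neg_smul]
  have sk₂ : ⁅a₁, a₂⁆ = -(2 : F) • g := by rw [sk, h₂, neg_smul]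
  have k₁ : ⁅g, ⁅a₁, a₀⁆⁆ = 0 := by rw [h₁]; simp
  have k₂ : ⁅g, ⁅a₂, a₁⁆⁆ = 0 := by rw [h₂]; simp
  rw [leibniz_lie, r₂, r₃] at k₁
  rw [leibniz_lie, r₃, r₄] at k₂
  simp only [sub_lie, lie_sub, lie_self] at k₁ k₂
  -- Applying ad g to two of the known unit brackets shows that the three brackets at distance two
  -- agree; d is their common value.
  obtain ⟨d, hd⟩ : ∃ d : L, ⁅a₁, m₁⁆ = d := ⟨_, rfl⟩
  have d₂ : ⁅a₂, a₀⁆ = d := by rw [← hd]; linear_combination (norm := module) (1 : F) • k₁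
  have d₃ : ⁅a₃, a₁⁆ = d := by rw [← d₂]; linear_combination (norm := module) (1 : F) • k₂
  have e₀ : ⁅d, a₀⁆ = (2 : F) • (a₂ - m₂) := by
    rw [← hd, lie_lie, sk₀, h₁, lie_smul, lie_smul, sk a₁ g, sk m₁ g, r₃, r₁]
    module
  have e₁ : ⁅d, a₁⁆ = (2 : F) • (a₃ - m₁) := by
    rw [← d₂, lie_lie, sk₁, h₂, lie_smul, lie_smul, sk a₂ g, sk a₀ g, r₄, r₂]
    module
  have g₁ : ⁅g, d⁆ = ⁅a₂, m₁⁆ - ⁅a₁, m₂⁆ := by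
    rw [← hd, leibniz_lie, r₁, r₃, sub_lie, lie_sub, h₀, h₁]
    module
  have g₂ : ⁅g, d⁆ = ⁅a₃, a₀⁆ - ⁅a₂, m₁⁆ := by
    rw [← d₂, leibniz_lie, r₂, r₄, sub_lie, lie_sub, h₂, h₁]
    module
  have g₃ : ⁅g, d⁆ = ⁅a₄, a₁⁆ - (2 : F) • g + ⁅a₃, a₂⁆ - ⁅a₃, a₀⁆ := by
    rw [← d₃, leibniz_lie, r₃, r₅, sub_lie, lie_sub, h₂]
    module
  have g₄ : ⁅d, ⁅a₁, a₀⁆⁆ = (2 : F) • ⁅a₃, a₀⁆ - (2 : F) • ⁅a₁, m₂⁆ := by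
    rw [leibniz_lie, e₀, e₁, smul_lie, lie_smul, sub_lie, lie_sub, sk₀, sk₂]
    module
  rw [h₁, lie_smul, sk d g] at g₄
  -- `g₁` and `g₂` together give 4[g, d] = 2([a₃, a₀] - [a₁, m₂]), while `g₄` says that the right
  -- side is -2[g, d].
  have gd : ⁅g, d⁆ = 0 := by
    have h6 : (6 : F) • ⁅g, d⁆ = 0 := by
      linear_combination (norm := module) (2 : F) • g₁ + (2 : F) • g₂ - g₄
    exact (smul_eq_zero.1 h6).resolve_left (by norm_num)
  have e₂ : ⁅d, a₂⁆ = (2 : F) • (a₄ - a₀) := by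
    have h : ⁅d, ⁅g, a₁⁆⁆ = (2 : F) • (a₄ - a₂ - (a₀ - m₂)) := by
      rw [leibniz_lie, e₁, sk d g, gd, lie_smul, lie_sub, r₅, r₁]
      simp
    rw [r₃, lie_sub, e₀] at h
    linear_combination (norm := module) h
  have g₅ : ⁅d, ⁅a₂, a₁⁆⁆ = (2 : F) • (⁅a₄, a₁⁆ + (2 : F) • g - ⁅a₃, a₂⁆ - ⁅a₂, m₁⁆) := by
    rw [leibniz_lie, e₁, e₂, smul_lie, lie_smul, sub_lie, lie_sub, sk₁, sk a₂ a₃]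
    module
  rw [h₂, lie_smul, sk d g, gd] at g₅
  -- With [g, d] = 0, the unknown brackets [a₄, a₁], [a₃, a₀], [a₂, m₁] cancel and only the wanted
  -- one survives.
  have h4 : (4 : F) • (⁅a₃, a₂⁆ - (2 : F) • g) = 0 := by
    rw [gd] at g₂ g₃
    linear_combination (norm := module) g₅ - (2 : F) • g₃ - (2 : F) • g₂
  exact sub_eq_zero.1 ((smul_eq_zero.1 h4).resolve_left (by norm_num))

/-- The two-sided sequence generated by `u`, `v` under `a (m + 1) = a (m - 1) + ⁅g, a m⁆`. -/
def onsagerShift (g : L) : Equiv.Perm (L × L) where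
  toFun p := (p.2, p.1 + ⁅g, p.2⁆)
  invFun p := (p.2 - ⁅g, p.1⁆, p.1)
  left_inv p := by simp
  right_inv p := by simp

/-- The two-sided sequence with initial terms `u`, `v` and
`a (m + 1) = a (m - 1) + ⁅g, a m⁆`. -/
def onsagerSeq (g u v : L) (m : ℤ) : L := ((onsagerShift g ^ m) (u, v)).1

theorem onsagerSeq_zero (g u v : L) : onsagerSeq g u v 0 = u := by simp [onsagerSeq]

theorem onsagerSeq_succ (g u v : L) (m : ℤ) :
    onsagerSeq g u v (m + 1) = ((onsagerShift g ^ m) (u, v)).2 := by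
  rw [onsagerSeq, add_comm, zpow_one_add]
  rfl

theorem onsagerSeq_one (g u v : L) : onsagerSeq g u v 1 = v := by
  simpa using onsagerSeq_succ g u v 0

theorem onsagerSeq_rec (g u v : L) (m : ℤ) :
    ⁅g, onsagerSeq g u v m⁆ = onsagerSeq g u v (m + 1) - onsagerSeq g u v (m - 1) := by
  obtain ⟨k, rfl⟩ : ∃ k, m = k + 1 := ⟨m - 1, by ring⟩
  rw [onsagerSeq_succ g u v (k + 1), add_sub_cancel_right, onsagerSeq_succ, add_comm k 1,
    zpow_one_add]
  simp [onsagerShift, onsagerSeq]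

theorem onsager_unit_brackets_nat {g : L} {a : ℤ → L}
    (hr : ∀ m, ⁅g, a m⁆ = a (m + 1) - a (m - 1))
    (h₀ : ⁅a 0, a (-1)⁆ = (2 : F) • g) (h₁ : ⁅a 1, a 0⁆ = (2 : F) • g)
    (h₂ : ⁅a 2, a 1⁆ = (2 : F) • g) (n : ℕ) :
    ⁅a (n : ℤ), a (n - 1)⁆ = (2 : F) • g ∧ ⁅a (n + 1 : ℤ), a n⁆ = (2 : F) • g ∧
      ⁅a (n + 2 : ℤ), a (n + 1)⁆ = (2 : F) • g := by
  induction n with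
  | zero => simpa using ⟨h₀, h₁, h₂⟩
  | succ n ih =>
    obtain ⟨i₀, i₁, i₂⟩ := ih
    have e (k l : ℤ) (h : k = l) : a k = a l := by rw [h]
    have := onsager_step (F := F) (g := g) (m₂ := a (n - 1 - 1)) (m₁ := a (n - 1)) (a₀ := a n)
      (a₁ := a (n + 1)) (a₂ := a (n + 2)) (a₃ := a (n + 3)) (a₄ := a (n + 4))
      (by rw [hr]; congr 2; ring) (by rw [hr])
      (by rw [hr]; congr 2; ring)
      (by rw [hr]; congr 2; ring)
      (by rw [hr]; congr 2; ring) i₀ i₁ i₂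
    push_cast
    refine ⟨?_, ?_, ?_⟩
    · rw [e _ _ (show (n : ℤ) + 1 - 1 = n by ring)]; exact i₁
    · rw [e _ _ (show (n : ℤ) + 1 + 1 = n + 2 by ring)]; exact i₂
    · rw [e _ _ (show (n : ℤ) + 1 + 1 = n + 2 by ring), e _ _ (show (n : ℤ) + 1 + 2 = n + 3 by ring)]
      exact this

theorem onsager_unit_brackets {g : L} {a : ℤ → L}
    (hr : ∀ m, ⁅g, a m⁆ = a (m + 1) - a (m - 1))
    (h₀ : ⁅a 0, a (-1)⁆ = (2 : F) • g) (h₁ : ⁅a 1, a 0⁆ = (2 : F) • g)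
    (h₂ : ⁅a 2, a 1⁆ = (2 : F) • g) (m : ℤ) : ⁅a (m + 1), a m⁆ = (2 : F) • g := by
  rcases le_total 0 m with hm | hm
  · lift m to ℕ using hm
    exact (onsager_unit_brackets_nat hr h₀ h₁ h₂ m).2.1
  · obtain ⟨n, rfl⟩ : ∃ n : ℕ, m = -n := ⟨m.natAbs, by omega⟩
    -- The reflection k ↦ 1 - k, with g replaced by -g, preserves the recurrence and exchanges the
    -- outer two initial brackets, so negative indices follow from nonnegative ones.
    have key := (onsager_unit_brackets_nat (F := F) (g := -g) (a := fun k => a (1 - k))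
      (fun k => by
        rw [neg_lie, hr, neg_sub, show 1 - k - 1 = 1 - (k + 1) by ring,
          show 1 - k + 1 = 1 - (k - 1) by ring])
      (by rw [← lie_skew, smul_neg, ← h₂]; norm_num)
      (by rw [← lie_skew, smul_neg, ← h₁]; norm_num)
      (by rw [← lie_skew, smul_neg, ← h₀]; norm_num) n).2.1
    simp only [smul_neg] at key
    rw [← lie_skew, show -(n : ℤ) = 1 - (n + 1) by ring, show 1 - ((n : ℤ) + 1) + 1 = 1 - n by ring,
      key, neg_neg]

/-- Half the bracket `⁅a n, a 0⁆`. -/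
def onsagerG (F : Type*) {L : Type*} [Field F] [LieRing L] [LieAlgebra F L] (a : ℤ → L)
    (n : ℤ) : L := (2 : F)⁻¹ • ⁅a n, a 0⁆

/-- The Onsager relations at distance `n`. -/
def OnsagerRel (F : Type*) {L : Type*} [Field F] [LieRing L] [LieAlgebra F L] (a : ℤ → L)
    (n : ℤ) : Prop :=
  (∀ k : ℤ, ⁅a (k + n), a k⁆ = (2 : F) • onsagerG F a n) ∧
    ∀ k : ℤ, ⁅onsagerG F a n, a k⁆ = a (k + n) - a (k - n)

theorem OnsagerRel.neg {a : ℤ → L} {n : ℤ} (h : OnsagerRel F a n) :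
    onsagerG F a (-n) = -onsagerG F a n ∧ OnsagerRel F a (-n) := by
  have two : (2 : F) ≠ 0 := two_ne_zero
  have e (k : ℤ) : ⁅a (k + -n), a k⁆ = -((2 : F) • onsagerG F a n) := by
    rw [← lie_skew, ← h.1 (k + -n)]
    congr 3
    ring
  have hG : onsagerG F a (-n) = -onsagerG F a n := by
    have := e 0
    rw [zero_add] at this
    rw [onsagerG, this, smul_neg, inv_smul_smul₀ two]
  refine ⟨hG, fun k => by rw [e, hG, smul_neg], fun k => ?_⟩
  rw [hG, neg_lie, h.2, neg_sub, sub_neg_eq_add, ← sub_eq_add_neg]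

/-- Applying ad g to the relation at distance n + 1 shows that the brackets at distance n + 2 form
an arithmetic progression in the base point, with difference D. A second evaluation of D gives (n +
2)D = 0, so characteristic 0 makes them constant. -/
theorem OnsagerRel.succ {g : L} {a : ℤ → L} (hr : ∀ m, ⁅g, a m⁆ = a (m + 1) - a (m - 1))
    (hu : ∀ m, ⁅a (m + 1), a m⁆ = (2 : F) • g) {n : ℕ}
    (h₀ : OnsagerRel F a n) (h₁ : OnsagerRel F a (n + 1)) : OnsagerRel F a (n + 2) := by
  have two : (2 : F) ≠ 0 := two_ne_zero
  obtain ⟨D, hD⟩ : ∃ D, ⁅g, (2 : F) • onsagerG F a (n + 1)⁆ = D := ⟨_, rfl⟩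
  have step (k : ℤ) : ⁅a (k + 1 + (n + 2)), a (k + 1)⁆ = ⁅a (k + (n + 2)), a k⁆ + D := by
    have h := h₁.1 (k + 1)
    have h2 := h₀.1 (k + 1)
    have h3 := h₀.1 (k + 2)
    rw [← hD, ← h, leibniz_lie, hr, hr, sub_lie, lie_sub,
      show k + 1 + ((n : ℤ) + 1) + 1 = k + 1 + (n + 2) by ring,
      show k + 1 + ((n : ℤ) + 1) - 1 = k + 1 + n by ring,
      show k + 1 + ((n : ℤ) + 1) = k + (n + 2) by ring,
      show k + 1 + 1 = k + 2 by ring, show k + 1 - 1 = k by ring, h2,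
      show k + ((n : ℤ) + 2) = k + 2 + n by ring, h3]
    module
  have steps (m : ℕ) : ⁅a (m + (n + 2)), a m⁆ = ⁅a (n + 2), a 0⁆ + (m : F) • D := by
    induction m with
    | zero => simp
    | succ m ih =>
      push_cast
      rw [step, ih]
      module
  have hD0 : D = 0 := by
    -- The inner bracket is 2g, so the left side is also -D. The Leibniz expansion compares two
    -- distance n + 2 brackets whose base points are n + 1 apart; the distance n terms cancel.
    have h : ⁅onsagerG F a (n + 1), ⁅a ((n + 1 : ℕ) + 1), a (n + 1 : ℕ)⁆⁆ =
        ((n + 1 : ℕ) : F) • D := by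
      have e1 := steps (n + 1)
      have e2 := h₀.1 1
      have e3 := h₀.1 ((n + 1 : ℕ) + 1)
      rw [leibniz_lie, h₁.2, h₁.2, sub_lie, lie_sub,
        show ((n + 1 : ℕ) : ℤ) + 1 + (n + 1) = (n + 1 : ℕ) + (n + 2) by ring, e1,
        show ((n + 1 : ℕ) : ℤ) + 1 - (n + 1) = 1 by push_cast; ring,
        show ((n + 1 : ℕ) : ℤ) - (n + 1) = 0 by push_cast; ring,
        show ((n + 1 : ℕ) : ℤ) + (n + 1) = (n + 1 : ℕ) + 1 + n by push_cast; ring,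
        ← lie_skew (a 1), ← lie_skew (a _) (a ((n + 1 : ℕ) + 1 + n)), e3,
        show ((n + 1 : ℕ) : ℤ) = 1 + n by push_cast; ring, e2,
        show (1 : ℤ) + n + 1 = n + 2 by ring]
      module
    rw [hu, lie_smul, ← lie_skew, smul_neg, ← lie_smul, hD] at h
    have h' : ((n + 2 : ℕ) : F) • D = 0 := by
      push_cast at h ⊢
      linear_combination (norm := module) -h
    exact (smul_eq_zero.1 h').resolve_left (Nat.cast_ne_zero.2 (by omega))
  have hG : (2 : F) • onsagerG F a (n + 2) = ⁅a (n + 2), a 0⁆ := by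
    rw [onsagerG, smul_inv_smul₀ two]
  have first (k : ℤ) : ⁅a (k + (n + 2)), a k⁆ = (2 : F) • onsagerG F a (n + 2) := by
    rw [hD0] at step
    induction k using Int.induction_on with
    | zero => rw [hG, zero_add]
    | succ k ih => rw [step, ih, add_zero]
    | pred k ih =>
      have := step (-k - 1)
      rwa [sub_add_cancel, ih, add_zero, eq_comm] at this
  refine ⟨first, fun k => ?_⟩
  have h : (2 : F) • ⁅onsagerG F a (n + 2), a k⁆ = (2 : F) • (a (k + (n + 2)) - a (k - (n + 2))) := by
    have e1 := h₁.1 k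
    have e2 := hu (k - 1)
    rw [sub_add_cancel] at e2
    rw [← smul_lie, ← first (k - 1), show k - 1 + ((n : ℤ) + 2) = k + (n + 1) by ring, lie_lie,
      ← lie_skew (a (k - 1)) (a k), e2, e1, lie_neg, lie_smul, lie_smul, ← lie_skew _ g, hr,
      ← lie_skew _ (onsagerG F a (n + 1)), h₁.2,
      show k + ((n : ℤ) + 1) + 1 = k + (n + 2) by ring,
      show k + ((n : ℤ) + 1) - 1 = k - 1 + (n + 1) by ring,
      show k - 1 - ((n : ℤ) + 1) = k - (n + 2) by ring]
    module
  exact smul_right_injective L two h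

theorem onsagerRel {g : L} {a : ℤ → L} (hr : ∀ m, ⁅g, a m⁆ = a (m + 1) - a (m - 1))
    (hu : ∀ m, ⁅a (m + 1), a m⁆ = (2 : F) • g) (n : ℤ) : OnsagerRel F a n := by
  have two : (2 : F) ≠ 0 := two_ne_zero
  have nat (n : ℕ) : OnsagerRel F a n ∧ OnsagerRel F a (n + 1) := by
    induction n with
    | zero =>
      have h1 : onsagerG F a 1 = g := by
        rw [onsagerG, show (1 : ℤ) = 0 + 1 by ring, hu, inv_smul_smul₀ two]
      simp only [Nat.cast_zero, zero_add]
      exact ⟨⟨fun k => by simp [onsagerG], fun k => by simp [onsagerG]⟩,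
        fun k => by rw [hu, h1], fun k => by rw [h1, hr]⟩
    | succ n ih =>
      push_cast
      rw [add_assoc, one_add_one_eq_two]
      exact ⟨ih.2, ih.1.succ hr hu ih.2⟩
  rcases le_total 0 n with hn | hn
  · lift n to ℕ using hn
    exact (nat n).1
  · obtain ⟨m, rfl⟩ : ∃ m : ℕ, n = -m := ⟨n.natAbs, by omega⟩
    exact (nat m).1.neg.2

omit [CharZero F] in
/-- The submodule spanned by an Onsager sequence and its brackets is stable under
the sequence. -/
theorem onsager_lie_mem {a : ℤ → L} (h : ∀ n, OnsagerRel F a n) (k : ℤ) {v : L}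
    (hv : v ∈ Submodule.span F (Set.range a) ⊔ Submodule.span F (Set.range (onsagerG F a))) :
    ⁅a k, v⁆ ∈ Submodule.span F (Set.range a) ⊔ Submodule.span F (Set.range (onsagerG F a)) := by
  set W := Submodule.span F (Set.range a) ⊔ Submodule.span F (Set.range (onsagerG F a))
  suffices W ≤ W.comap (LieModule.toEnd F L L (a k) : L →ₗ[F] L) from this hv
  refine sup_le (Submodule.span_le.2 ?_) (Submodule.span_le.2 ?_)
  · rintro _ ⟨m, rfl⟩
    have e := (h (k - m)).1 m
    rw [add_sub_cancel] at e
    change ⁅a k, a m⁆ ∈ W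
    rw [e]
    exact W.smul_mem _ (Submodule.mem_sup_right (Submodule.subset_span ⟨_, rfl⟩))
  · rintro _ ⟨m, rfl⟩
    change ⁅a k, onsagerG F a m⁆ ∈ W
    rw [← lie_skew, (h m).2]
    exact W.neg_mem (W.sub_mem (Submodule.mem_sup_left (Submodule.subset_span ⟨_, rfl⟩))
      (Submodule.mem_sup_left (Submodule.subset_span ⟨_, rfl⟩)))

omit [CharZero F] in
/-- A submodule stable under the bracket with each element of `s` and containing `s` contains the
Lie subalgebra generated by `s`. -/
theorem lieSpan_le_of_lie_mem {s : Set L} {W : Submodule F L} (hs : s ⊆ W)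
    (hW : ∀ u ∈ s, ∀ v ∈ W, ⁅u, v⁆ ∈ W) {u : L} (hu : u ∈ LieSubalgebra.lieSpan F L s) :
    u ∈ W ∧ ∀ v ∈ W, ⁅u, v⁆ ∈ W := by
  induction hu using LieSubalgebra.lieSpan_induction with
  | mem u hu => exact ⟨hs hu, hW u hu⟩
  | zero => simp
  | add u v _ _ hu hv =>
    exact ⟨W.add_mem hu.1 hv.1, fun w hw => by
      rw [add_lie]; exact W.add_mem (hu.2 w hw) (hv.2 w hw)⟩
  | smul t u _ hu =>
    exact ⟨W.smul_mem t hu.1, fun w hw => by rw [smul_lie]; exact W.smul_mem t (hu.2 w hw)⟩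
  | lie u v _ _ hu hv =>
    refine ⟨hu.2 v hv.1, fun w hw => ?_⟩
    rw [lie_lie]
    exact W.sub_mem (hu.2 _ (hv.2 w hw)) (hv.2 _ (hu.2 w hw))

/-- The Lie subalgebra generated by a pair satisfying the Dolan-Grady relations is spanned by an
Onsager sequence and its brackets. -/
theorem dolanGrady_lieSpan {A B : L} (hA : ⁅A, ⁅A, ⁅A, B⁆⁆⁆ = (4 : F) • ⁅A, B⁆)
    (hB : ⁅B, ⁅B, ⁅B, A⁆⁆⁆ = (4 : F) • ⁅B, A⁆) :
    ∃ a : ℤ → L, a 0 = A ∧ a 1 = B ∧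
      (∀ m, ⁅(2 : F)⁻¹ • ⁅B, A⁆, a m⁆ = a (m + 1) - a (m - 1)) ∧
      (∀ m, onsagerG F a (-m) = -onsagerG F a m) ∧
      ∀ u ∈ LieSubalgebra.lieSpan F L {A, B},
        u ∈ Submodule.span F (Set.range a) ⊔ Submodule.span F (Set.range (onsagerG F a)) := by
  have two : (2 : F) ≠ 0 := two_ne_zero
  obtain ⟨g, hg⟩ : ∃ g : L, (2 : F)⁻¹ • ⁅B, A⁆ = g := ⟨_, rfl⟩
  have hBA : ⁅B, A⁆ = (2 : F) • g := by rw [← hg, smul_inv_smul₀ two]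
  have hAB : ⁅A, B⁆ = -((2 : F) • g) := by rw [← lie_skew, hBA]
  have hAg : ⁅A, ⁅A, g⁆⁆ = (4 : F) • g := by
    rw [hAB] at hA
    simp only [lie_neg, lie_smul, smul_neg, neg_inj] at hA
    rw [smul_comm] at hA
    exact smul_right_injective L two hA
  have hBg : ⁅B, ⁅B, g⁆⁆ = (4 : F) • g := by
    rw [hBA] at hB
    simp only [lie_smul] at hB
    rw [smul_comm] at hB
    exact smul_right_injective L two hB
  obtain ⟨a, ha⟩ : ∃ a, onsagerSeq g A B = a := ⟨_, rfl⟩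
  have a0 : a 0 = A := by rw [← ha, onsagerSeq_zero]
  have a1 : a 1 = B := by rw [← ha, onsagerSeq_one]
  have hr (m : ℤ) : ⁅g, a m⁆ = a (m + 1) - a (m - 1) := by rw [← ha, onsagerSeq_rec]
  have am : a (-1) = B - ⁅g, A⁆ := by
    have := hr 0
    rw [zero_add, zero_sub, a0, a1] at this
    rw [this, sub_sub_cancel]
  have a2 : a 2 = A + ⁅g, B⁆ := by
    have := hr 1
    rw [sub_self, one_add_one_eq_two, a0, a1] at this
    rw [this, add_sub_cancel]
  -- The Dolan-Grady relations enter only here: [A, [A, g]] = 4g and [B, [B, g]] = 4g give the unit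
  -- brackets on either side of [B, A] = 2g.
  have hu := onsager_unit_brackets (F := F) hr
    (by rw [a0, am, lie_sub, hAB, ← lie_skew g A, lie_neg, hAg]; module)
    (by rw [a0, a1, hBA])
    (by rw [a1, a2, add_lie, hAB, ← lie_skew, ← lie_skew g B, lie_neg, hBg]; module)
  have h := onsagerRel hr hu
  refine ⟨a, a0, a1, fun m => by rw [hg, hr], fun m => (h m).neg.1, fun u hu => ?_⟩
  refine (lieSpan_le_of_lie_mem ?_ ?_ hu).1
  · rintro _ (rfl | rfl)
    · exact Submodule.mem_sup_left (Submodule.subset_span ⟨0, a0⟩)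
    · exact Submodule.mem_sup_left (Submodule.subset_span ⟨1, a1⟩)
  · rintro _ (rfl | rfl) v hv
    · rw [← a0]; exact onsager_lie_mem h 0 hv
    · rw [← a1]; exact onsager_lie_mem h 1 hv

end Onsager

/-! ### Matrices attached to pairs of points of the projective line. -/

section EigenMatrix

variable {K : Type*} [Field K]

/-- The traceless matrix with eigenvalue `-1` on `(p, 1)` and `1` on `(q, 1)`. -/
def eigenMatrix (p q : K) : Matrix (Fin 2) (Fin 2) K :=
  !![(p + q) / (q - p), -(2 * p * q) / (q - p); 2 / (q - p), -(p + q) / (q - p)]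

theorem lie_fin_two (a b c d a' b' c' d' : K) :
    ⁅!![a, b; c, d], !![a', b'; c', d']⁆ =
      !![b * c' - b' * c, a * b' + b * d' - a' * b - b' * d;
        c * a' + d * c' - c' * a - d' * c, c * b' - c' * b] := by
  rw [Ring.lie_def, Matrix.mul_fin_two, Matrix.mul_fin_two]
  ext i j
  fin_cases i <;> fin_cases j <;> simp <;> ring

theorem eigenMatrix_skew (p q : K) : eigenMatrix p q + eigenMatrix q p = 0 := by
  have h : q - p = -(p - q) := by ring
  simp only [eigenMatrix, h, div_neg]
  ext i j
  fin_cases i <;> fin_cases j <;> simp <;> ring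

theorem eigenMatrix_triangle {p q r : K} (hpq : p ≠ q) (hqr : q ≠ r) :
    ⁅eigenMatrix p q, eigenMatrix q r⁆ =
      (2 : K) • eigenMatrix p q + (2 : K) • eigenMatrix q r := by
  have h₁ := sub_ne_zero.2 hpq.symm
  have h₂ := sub_ne_zero.2 hqr.symm
  simp only [eigenMatrix, lie_fin_two]
  ext i j
  fin_cases i <;> fin_cases j <;> simp <;> field_simp <;> ring

/-- A matrix with eigenvalues ±1 acts by commutators with eigenvalues 0 and ±2, so its adjoint map
satisfies X³ = 4X. Hence the points need not be pairwise distinct, which the likeness proofs allow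
for. -/
theorem eigenMatrix_dolanGrady {p q r t : K} (hpq : p ≠ q) (hrt : r ≠ t) :
    ⁅eigenMatrix p q, ⁅eigenMatrix p q, ⁅eigenMatrix p q, eigenMatrix r t⁆⁆⁆ =
      (4 : K) • ⁅eigenMatrix p q, eigenMatrix r t⁆ := by
  have h₁ := sub_ne_zero.2 hpq.symm
  have h₂ := sub_ne_zero.2 hrt.symm
  simp only [eigenMatrix, lie_fin_two]
  ext i j
  fin_cases i <;> fin_cases j <;> simp <;> field_simp <;> ring

end EigenMatrix

/-! ### The evaluation representation of the tetrahedron algebra. -/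

section Model

variable (F K : Type*) [Field F] [CharZero F] [Field K] [CharZero K] [Algebra F K]
  [Algebra F[T;T⁻¹] K] [IsScalarTower F F[T;T⁻¹] K] [IsFractionRing F[T;T⁻¹] K]

/-- The loop parameter. -/
def loopVar : K := algebraMap F[T;T⁻¹] K (T 1)

/-- The four points of the projective line attached to the vertices of the tetrahedron. -/
def vertex : Fin 4 → K := ![-loopVar F K, -1, 1, loopVar F K]

omit [CharZero F] [CharZero K] [Algebra F K] [IsScalarTower F F[T;T⁻¹] K] in
theorem loopVar_ne_zero : loopVar F K ≠ 0 := by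
  intro h
  have := IsFractionRing.injective F[T;T⁻¹] K (h.trans (map_zero _).symm)
  exact (isUnit_T 1).ne_zero this

omit [CharZero F] [CharZero K] in
/-- A nonzero constant is not a Laurent polynomial multiple of `loopVar - c` for `c ≠ 0`. -/
theorem mul_loopVar_sub_ne (c : Fˣ) (f : F[T;T⁻¹]) {d : F} (hd : d ≠ 0) :
    algebraMap F[T;T⁻¹] K f * (loopVar F K - algebraMap F K c) ≠ algebraMap F K d := by
  intro h
  have e (x : F) : algebraMap F K x = algebraMap F[T;T⁻¹] K (C x) := by
    rw [IsScalarTower.algebraMap_apply F F[T;T⁻¹] K, C_eq_algebraMap]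
  rw [loopVar, e, e, ← map_sub, ← map_mul] at h
  -- Evaluate the Laurent polynomials at c, which is legitimate because c is a unit; the left factor
  -- vanishes there.
  have h' := congrArg (eval₂ (RingHom.id F) c) (IsFractionRing.injective _ _ h)
  simp only [map_mul, map_sub, eval₂_T, eval₂_C] at h'
  simp at h'
  exact hd h'.symm

theorem loopVar_ne_one : loopVar F K ≠ 1 := by
  intro h
  apply mul_loopVar_sub_ne F K (-1) 1 (two_ne_zero (α := F))
  rw [h, map_one, Units.val_neg, Units.val_one, map_neg, map_one, map_ofNat]
  norm_num

omit [CharZero K] in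
theorem loopVar_ne_neg_one : loopVar F K ≠ -1 := by
  intro h
  apply mul_loopVar_sub_ne F K 1 (-1) (two_ne_zero (α := F))
  rw [h, map_neg, map_one, Units.val_one, map_one, map_ofNat]
  norm_num

theorem vertex_injective : Function.Injective (vertex F K) := by
  have h0 := loopVar_ne_zero F K
  have h1 := loopVar_ne_one F K
  have h2 := loopVar_ne_neg_one F K
  have h3 : (-1 : K) ≠ 1 := by norm_num
  have h4 : loopVar F K ≠ - loopVar F K := fun h => h0 (self_eq_neg.1 h)
  have h5 : -loopVar F K ≠ 1 := fun h => h2 (by rw [← h, neg_neg])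
  intro i j h
  fin_cases i <;> fin_cases j <;> simp_all [vertex, eq_comm]

/-- The evaluation representation on the free Lie algebra. -/
def freeToModel : FreeLieAlgebra F Gen →ₗ⁅F⁆ Matrix (Fin 2) (Fin 2) K :=
  FreeLieAlgebra.lift F fun p : Gen => eigenMatrix (vertex F K p.1.1) (vertex F K p.1.2)

omit [CharZero F] [CharZero K] [IsScalarTower F F[T;T⁻¹] K] [IsFractionRing F[T;T⁻¹] K] in
theorem freeToModel_freeGen (i j : Fin 4) (h : i ≠ j) :
    freeToModel F K (freeGen F i j h) = eigenMatrix (vertex F K i) (vertex F K j) := by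
  simp [freeToModel, freeGen, FreeLieAlgebra.lift_of_apply]

theorem relIdeal_le_ker : relIdeal F ≤ (freeToModel F K).ker := by
  have sc (n : ℕ) (M : Matrix (Fin 2) (Fin 2) K) : (n : F) • M = (n : K) • M := by
    rw [Nat.cast_smul_eq_nsmul, Nat.cast_smul_eq_nsmul]
  have s2 := sc 2
  have s4 := sc 4
  push_cast at s2 s4
  refine LieSubmodule.lieSpan_le.2 ?_
  rintro r (⟨i, j, hij⟩ | ⟨h, i, j, hi, hj, ij⟩ | ⟨h, i, j, k, hi, hj, hk, ij, ik, jk⟩)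
  · simp [freeToModel_freeGen, eigenMatrix_skew]
  · have := eigenMatrix_triangle ((vertex_injective F K).ne hi) ((vertex_injective F K).ne ij)
    simp [freeToModel_freeGen, this, s2]
  · have := eigenMatrix_dolanGrady ((vertex_injective F K).ne hi) ((vertex_injective F K).ne jk)
    simp [freeToModel_freeGen, this, s4]

/-- The evaluation representation of the tetrahedron algebra. -/
def toModel : Tet F →ₗ⁅F⁆ Matrix (Fin 2) (Fin 2) K where
  toLinearMap := Submodule.liftQ (relIdeal F).toSubmodule
    (freeToModel F K : FreeLieAlgebra F Gen →ₗ[F] Matrix (Fin 2) (Fin 2) K) (relIdeal_le_ker F K)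
  map_lie' := by
    intro x y
    obtain ⟨x, rfl⟩ := Submodule.Quotient.mk_surjective _ x
    obtain ⟨y, rfl⟩ := Submodule.Quotient.mk_surjective _ y
    exact LieHom.map_lie (freeToModel F K) x y

theorem toModel_gen (i j : Fin 4) (h : i ≠ j) :
    toModel F K (gen F i j h) = eigenMatrix (vertex F K i) (vertex F K j) :=
  freeToModel_freeGen F K i j h

end Model

/-! ### The defining relations in the quotient. -/

section Generators

variable (F : Type*) [Field F]

theorem gen_skew (i j : Fin 4) (h : i ≠ j) : gen F i j h = -gen F j i h.symm := by
  have := LieSubmodule.subset_lieSpan (R := F) (L := FreeLieAlgebra F Gen) (IsRelator.skew (F := F) i j h)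
  have := (LieSubmodule.Quotient.mk_eq_zero (N := relIdeal F)).2 this
  exact eq_neg_of_add_eq_zero_left this

theorem gen_triangle (h i j : Fin 4) (hi : h ≠ i) (hj : h ≠ j) (ij : i ≠ j) :
    ⁅gen F h i hi, gen F i j ij⁆ = (2 : F) • gen F h i hi + (2 : F) • gen F i j ij := by
  have := LieSubmodule.subset_lieSpan (R := F) (L := FreeLieAlgebra F Gen) (IsRelator.triangle (F := F) h i j hi hj ij)
  have := (LieSubmodule.Quotient.mk_eq_zero (N := relIdeal F)).2 this
  exact sub_eq_zero.1 this

theorem gen_dolanGrady (h i j k : Fin 4) (hi : h ≠ i) (hj : h ≠ j) (hk : h ≠ k) (ij : i ≠ j)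
    (ik : i ≠ k) (jk : j ≠ k) :
    ⁅gen F h i hi, ⁅gen F h i hi, ⁅gen F h i hi, gen F j k jk⁆⁆⁆ =
      (4 : F) • ⁅gen F h i hi, gen F j k jk⁆ := by
  have := LieSubmodule.subset_lieSpan (R := F) (L := FreeLieAlgebra F Gen)
    (IsRelator.dolanGrady (F := F) h i j k hi hj hk ij ik jk)
  have := (LieSubmodule.Quotient.mk_eq_zero (N := relIdeal F)).2 this
  exact sub_eq_zero.1 this

end Generators

attribute [local instance 2000] Algebra.toModule

theorem smul_matrix_fin_two {R S : Type*} [Semiring S] [SMulZeroClass R S] (t : R) (a b c d : S) :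
    t • !![a, b; c, d] = !![t • a, t • b; t • c, t • d] := by
  ext i j
  fin_cases i <;> fin_cases j <;> simp

/-! ### Faithfulness on 𝒪 and on its one-generator extensions. -/

section Model

variable (F K : Type*) [Field F] [CharZero F] [Field K] [CharZero K] [Algebra F K]
  [Algebra F[T;T⁻¹] K] [IsScalarTower F F[T;T⁻¹] K] [IsFractionRing F[T;T⁻¹] K]

omit [CharZero F] [CharZero K] [Algebra F K] [IsScalarTower F F[T;T⁻¹] K] in
theorem algebraMap_T (m : ℤ) : algebraMap F[T;T⁻¹] K (T m) = loopVar F K ^ m := by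
  have h := loopVar_ne_zero F K
  induction m using Int.induction_on with
  | zero => simp
  | succ n ih => rw [T_add, map_mul, ih, zpow_add_one₀ h, loopVar]
  | pred n ih =>
    have : T (-(n : ℤ)) = (T (-(n : ℤ) - 1) * T 1 : F[T;T⁻¹]) := by rw [← T_add, sub_add_cancel]
    rw [this, map_mul] at ih
    rw [zpow_sub_one₀ h, ← ih, ← loopVar, mul_inv_cancel_right₀ h]

omit [CharZero F] [CharZero K] in
theorem linearIndependent_loopVar_zpow : LinearIndependent F fun m : ℤ => loopVar F K ^ m := by
  have h : LinearIndependent F fun m : ℤ => (T m : F[T;T⁻¹]) :=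
    (AddMonoidAlgebra.basis ℤ F).linearIndependent
  have := h.map_injOn (IsScalarTower.toAlgHom F F[T;T⁻¹] K).toLinearMap
    (fun _ _ _ _ h => IsFractionRing.injective F[T;T⁻¹] K h)
  convert this using 1
  ext m
  exact (algebraMap_T F K m).symm

theorem toModel_gen_one_two : toModel F K (gen F 1 2) = !![0, 1; 1, 0] := by
  rw [toModel_gen]
  ext i j
  fin_cases i <;> fin_cases j <;> simp [eigenMatrix, vertex] <;> norm_num

theorem toModel_gen_zero_three :
    toModel F K (gen F 0 3) = !![0, loopVar F K; (loopVar F K)⁻¹, 0] := by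
  have h := loopVar_ne_zero F K
  rw [toModel_gen]
  ext i j
  fin_cases i <;> fin_cases j <;> simp [eigenMatrix, vertex] <;> field_simp <;> norm_num

variable {F}

theorem toModel_onsagerSeq {a : ℤ → Tet F} (a0 : a 0 = gen F 1 2) (a1 : a 1 = gen F 0 3)
    (hr : ∀ m, ⁅(2 : F)⁻¹ • ⁅gen F 0 3, gen F 1 2⁆, a m⁆ = a (m + 1) - a (m - 1)) (m : ℤ) :
    toModel F K (a m) = !![0, loopVar F K ^ m; loopVar F K ^ (-m), 0] := by
  have h := loopVar_ne_zero F K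
  have hr' (m : ℤ) : toModel F K (a (m + 1)) = toModel F K (a (m - 1)) +
      ⁅!![(2 : K)⁻¹ * (loopVar F K - (loopVar F K)⁻¹), 0;
        0, -((2 : K)⁻¹ * (loopVar F K - (loopVar F K)⁻¹))], toModel F K (a m)⁆ := by
    have := congrArg (toModel F K) (hr m)
    rw [map_sub, LieHom.map_lie, map_smul, LieHom.map_lie, toModel_gen_one_two,
      toModel_gen_zero_three, lie_fin_two, smul_matrix_fin_two] at this
    rw [eq_add_of_sub_eq' this.symm]
    congr 3
    simp only [Algebra.smul_def, map_inv₀, map_ofNat]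
    simp
    ring
  -- The recurrence has order two, so consecutive pairs are carried through the induction in both
  -- directions.
  have key (m : ℤ) : toModel F K (a m) = !![0, loopVar F K ^ m; loopVar F K ^ (-m), 0] ∧
      toModel F K (a (m + 1)) = !![0, loopVar F K ^ (m + 1); loopVar F K ^ (-(m + 1)), 0] := by
    induction m using Int.induction_on with
    | zero =>
      rw [zero_add, a0, a1, toModel_gen_one_two, toModel_gen_zero_three]
      simp
    | succ n ih =>
      refine ⟨ih.2, ?_⟩
      rw [hr', ih.2, add_sub_cancel_right, ih.1, lie_fin_two]
      simp only [neg_add, zpow_add₀ h, zpow_neg, zpow_one]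
      ext i j
      fin_cases i <;> fin_cases j <;> simp <;> field_simp <;> ring
    | pred n ih =>
      rw [sub_add_cancel]
      refine ⟨?_, ih.1⟩
      have e := hr' (-n)
      rw [ih.2, ih.1, lie_fin_two] at e
      rw [← sub_eq_iff_eq_add.2 e]
      simp only [neg_add, neg_sub, neg_neg, zpow_add₀ h, zpow_sub₀ h, zpow_neg, zpow_one]
      ext i j
      fin_cases i <;> fin_cases j <;> simp <;> field_simp <;> ring
  exact (key m).1

theorem toModel_onsagerG {a : ℤ → Tet F}
    (ha : ∀ m, toModel F K (a m) = !![0, loopVar F K ^ m; loopVar F K ^ (-m), 0]) (m : ℤ) :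
    toModel F K (onsagerG F a m) =
      (2 : F)⁻¹ • !![loopVar F K ^ m - loopVar F K ^ (-m), 0;
        0, loopVar F K ^ (-m) - loopVar F K ^ m] := by
  rw [onsagerG, map_smul, LieHom.map_lie, ha, ha, lie_fin_two]
  simp

/-- A matrix entry of the evaluation representation, as a linear functional over `F`. -/
def modelEntry (F K : Type*) [Field F] [CharZero F] [Field K] [CharZero K] [Algebra F K]
    [Algebra F[T;T⁻¹] K] [IsScalarTower F F[T;T⁻¹] K] [IsFractionRing F[T;T⁻¹] K]
    (i j : Fin 2) : Tet F →ₗ[F] K :=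
  Matrix.entryLinearMap F K i j ∘ₗ (toModel F K : Tet F →ₗ[F] Matrix (Fin 2) (Fin 2) K)

theorem modelEntry_apply (i j : Fin 2) (v : Tet F) : modelEntry F K i j v = toModel F K v i j :=
  rfl

/-- The evaluation representation is faithful on the span of an Onsager sequence. -/
theorem eq_zero_of_toModel_eq_zero {a : ℤ → Tet F}
    (ha : ∀ m, toModel F K (a m) = !![0, loopVar F K ^ m; loopVar F K ^ (-m), 0])
    (hG : ∀ m, onsagerG F a (-m) = -onsagerG F a m) {v : Tet F}
    (hv : v ∈ Submodule.span F (Set.range a) ⊔ Submodule.span F (Set.range (onsagerG F a)))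
    (h : toModel F K v = 0) : v = 0 := by
  have li := linearIndependent_iff.1 (linearIndependent_loopVar_zpow F K)
  obtain ⟨_, hx, _, hy, rfl⟩ := Submodule.mem_sup.1 hv
  obtain ⟨f, rfl⟩ := (Finsupp.mem_span_range_iff_exists_finsupp).1 hx
  obtain ⟨g, rfl⟩ := (Finsupp.mem_span_range_iff_exists_finsupp).1 hy
  simp only [← Finsupp.linearCombination_apply F] at h ⊢
  have h01 : modelEntry F K 0 1 _ = 0 := congrFun (congrFun h 0) 1
  have h00 : modelEntry F K 0 0 _ = 0 := congrFun (congrFun h 0) 0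
  rw [map_add, Finsupp.apply_linearCombination, Finsupp.apply_linearCombination] at h01 h00
  have a01 : modelEntry F K 0 1 ∘ a = fun m => loopVar F K ^ m := by
    ext m
    simp [modelEntry_apply, ha]
  have a00 : modelEntry F K 0 0 ∘ a = 0 := by
    ext m
    simp [modelEntry_apply, ha]
  have g01 : modelEntry F K 0 1 ∘ onsagerG F a = 0 := by
    ext m
    simp [modelEntry_apply, toModel_onsagerG K ha]
  have g00 : modelEntry F K 0 0 ∘ onsagerG F a =
      (2 : F)⁻¹ • ((fun m : ℤ => loopVar F K ^ m) - (fun m : ℤ => loopVar F K ^ m) ∘ Neg.neg) := by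
    ext m
    simp [modelEntry_apply, toModel_onsagerG K ha]
  -- The off-diagonal entry sees only the A_m, and the diagonal entry only the G_m.
  have f0 : f = 0 := li f (by simpa [a01, g01] using h01)
  have gneg : g - g.mapDomain Neg.neg = 0 := by
    apply li
    rw [map_sub, Finsupp.linearCombination_mapDomain]
    have hsmul (w : ℤ → K) : Finsupp.linearCombination F ((2 : F)⁻¹ • w) g =
        (2 : F)⁻¹ • Finsupp.linearCombination F w g := by
      simp only [Finsupp.linearCombination_apply, Finsupp.smul_sum, Pi.smul_apply,
        smul_comm _ (2 : F)⁻¹]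
    have hsub (w w' : ℤ → K) : Finsupp.linearCombination F (w - w') g =
        Finsupp.linearCombination F w g - Finsupp.linearCombination F w' g := by
      simp [Finsupp.linearCombination_apply, Finsupp.sum, smul_sub]
    rw [a00, g00, hsmul, hsub, Finsupp.linearCombination_zero_apply, zero_add] at h00
    exact (smul_eq_zero.1 h00).resolve_left (by norm_num)
  -- The diagonal entry shows only that the coefficients are even in m; since G_m is odd, their
  -- combination equals its own negative.
  have hself : Finsupp.linearCombination F (onsagerG F a) g =
      -Finsupp.linearCombination F (onsagerG F a) g := by
    conv_lhs => rw [sub_eq_zero.1 gneg, Finsupp.linearCombination_mapDomain]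
    have : onsagerG F a ∘ Neg.neg = -onsagerG F a := by
      ext m
      exact hG m
    rw [this]
    simp [Finsupp.linearCombination_apply, Finsupp.sum]
  have h2 : (2 : F) • Finsupp.linearCombination F (onsagerG F a) g = 0 := by
    rw [two_smul]
    nth_rewrite 1 [hself]
    exact neg_add_cancel _
  rw [f0, map_zero, zero_add, (smul_eq_zero.1 h2).resolve_left two_ne_zero]

theorem toModel_entry_mem_range {a : ℤ → Tet F}
    (ha : ∀ m, toModel F K (a m) = !![0, loopVar F K ^ m; loopVar F K ^ (-m), 0]) {v : Tet F}
    (hv : v ∈ Submodule.span F (Set.range a) ⊔ Submodule.span F (Set.range (onsagerG F a))) :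
    ∃ f : F[T;T⁻¹], toModel F K v 1 0 = algebraMap F[T;T⁻¹] K f := by
  suffices Submodule.span F (Set.range a) ⊔ Submodule.span F (Set.range (onsagerG F a)) ≤
      (LinearMap.range (IsScalarTower.toAlgHom F F[T;T⁻¹] K).toLinearMap).comap
        (modelEntry F K 1 0) by
    obtain ⟨f, hf⟩ := this hv
    exact ⟨f, hf.symm⟩
  refine sup_le (Submodule.span_le.2 ?_) (Submodule.span_le.2 ?_)
  · rintro _ ⟨m, rfl⟩
    exact ⟨T (-m), by simp [modelEntry_apply, ha, algebraMap_T]⟩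
  · rintro _ ⟨m, rfl⟩
    exact ⟨0, by simp [modelEntry_apply, toModel_onsagerG K ha]⟩

/-- The evaluation representation is faithful on the Onsager subalgebra extended by a generator
whose points differ by a nonunit Laurent polynomial. -/
theorem eq_zero_of_mem_onsager_sup (i j : Fin 4) (hij : i ≠ j) (c : Fˣ)
    (h : vertex F K j - vertex F K i = loopVar F K - algebraMap F K c) {v : Tet F}
    (hv : v ∈ (onsager F).toSubmodule ⊔ Submodule.span F {gen F i j hij})
    (h0 : toModel F K v = 0) : v = 0 := by
  obtain ⟨a, a0, a1, hr, hG, hs⟩ := dolanGrady_lieSpan (F := F) (A := gen F 1 2) (B := gen F 0 3)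
    (gen_dolanGrady F 1 2 0 3 (by decide) (by decide) (by decide) (by decide) (by decide)
      (by decide))
    (gen_dolanGrady F 0 3 1 2 (by decide) (by decide) (by decide) (by decide) (by decide)
      (by decide))
  have ha := toModel_onsagerSeq K a0 a1 hr
  obtain ⟨u, hu, w, hw, rfl⟩ := Submodule.mem_sup.1 hv
  obtain ⟨d, rfl⟩ := Submodule.mem_span_singleton.1 hw
  have hu' := hs u hu
  obtain ⟨f, hf⟩ := toModel_entry_mem_range K ha hu'
  have hne : loopVar F K - algebraMap F K c ≠ 0 := by
    rw [← h]
    exact sub_ne_zero.2 ((vertex_injective F K).ne hij.symm)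
  -- The lower left entry of the extra generator is 2/(s - c), while that of u is a Laurent
  -- polynomial f. Cancellation would give -f(s - c) = 2d.
  have hd : d = 0 := by
    by_contra hd
    apply mul_loopVar_sub_ne F K c (-f) (d := d * 2) (mul_ne_zero hd two_ne_zero)
    have := congrFun (congrFun h0 1) 0
    rw [map_add, map_smul, toModel_gen, Matrix.add_apply, hf] at this
    simp [eigenMatrix, h, Algebra.smul_def] at this
    rw [map_neg, eq_neg_of_add_eq_zero_left this, neg_neg, map_mul, map_ofNat]
    field_simp
  subst hd
  rw [zero_smul, add_zero] at h0 ⊢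
  exact eq_zero_of_toModel_eq_zero K ha hG hu' h0

end Model

/-! ### Stability under an extra generator, and membership in 𝒪. -/

section Membership

/-- If `u` brackets a generating set into the Lie subalgebra it generates plus the line of `u`,
then it does so with that whole subalgebra. -/
theorem lie_mem_lieSpan_sup {F L : Type*} [Field F] [LieRing L] [LieAlgebra F L] {s : Set L}
    {u : L} (hs : ∀ v ∈ s,
      ⁅u, v⁆ ∈ (LieSubalgebra.lieSpan F L s).toSubmodule ⊔ Submodule.span F {u}) {v : L}
    (hv : v ∈ (LieSubalgebra.lieSpan F L s).toSubmodule ⊔ Submodule.span F {u}) :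
    ⁅u, v⁆ ∈ (LieSubalgebra.lieSpan F L s).toSubmodule ⊔ Submodule.span F {u} := by
  set W := (LieSubalgebra.lieSpan F L s).toSubmodule ⊔ Submodule.span F {u}
  have main {x : L} (hx : x ∈ LieSubalgebra.lieSpan F L s) : ⁅u, x⁆ ∈ W := by
    -- W need not be a subalgebra a priori: an element x of the subalgebra preserves W once [u, x]
    -- is known to lie in W, and the induction supplies exactly that.
    have aux {x y : L} (hx : x ∈ LieSubalgebra.lieSpan F L s) (h : ⁅u, x⁆ ∈ W) (hy : y ∈ W) :
        ⁅x, y⁆ ∈ W := by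
      obtain ⟨o, ho, w, hw, rfl⟩ := Submodule.mem_sup.1 hy
      obtain ⟨c, rfl⟩ := Submodule.mem_span_singleton.1 hw
      rw [lie_add, lie_smul, ← lie_skew x u]
      exact W.add_mem (Submodule.mem_sup_left (LieSubalgebra.lie_mem _ hx ho))
        (W.smul_mem _ (W.neg_mem h))
    induction hx using LieSubalgebra.lieSpan_induction with
    | mem x hx => exact hs x hx
    | zero => simp
    | add x y _ _ hx hy => rw [lie_add]; exact W.add_mem hx hy
    | smul t x _ hx => rw [lie_smul]; exact W.smul_mem t hx
    | lie x y hx hy ihx ihy =>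
      rw [leibniz_lie, ← lie_skew]
      exact W.add_mem (W.neg_mem (aux hy ihy ihx)) (aux hx ihx ihy)
  obtain ⟨o, ho, w, hw, rfl⟩ := Submodule.mem_sup.1 hv
  obtain ⟨c, rfl⟩ := Submodule.mem_span_singleton.1 hw
  rw [lie_add, lie_smul, lie_self, smul_zero, add_zero]
  exact main ho

variable (F : Type*) [Field F]

theorem gen_one_two_mem : gen F 1 2 ∈ onsager F := LieSubalgebra.subset_lieSpan (by simp)

theorem gen_zero_three_mem : gen F 0 3 ∈ onsager F := LieSubalgebra.subset_lieSpan (by simp)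

theorem seqA_mem (n : ℕ) : seqA F n ∈ onsager F := by
  induction n with
  | zero => exact gen_one_two_mem F
  | succ n ih =>
    rw [seqA]
    split_ifs
    · exact LieSubalgebra.lie_mem _ (gen_zero_three_mem F) ih
    · exact LieSubalgebra.lie_mem _ (gen_one_two_mem F) ih

theorem seqB_mem (n : ℕ) : seqB F n ∈ onsager F := by
  induction n with
  | zero => exact gen_zero_three_mem F
  | succ n ih =>
    rw [seqB]
    split_ifs
    · exact LieSubalgebra.lie_mem _ (gen_one_two_mem F) ih
    · exact LieSubalgebra.lie_mem _ (gen_zero_three_mem F) ih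

theorem vecX_mem : ∀ i, vecX F i ∈ onsager F
  | 0 => seqA_mem F 0
  | _ + 1 => add_mem (seqA_mem F _) ((onsager F).smul_mem _ (seqB_mem F _))

theorem vecY_mem : ∀ i, vecY F i ∈ onsager F
  | 0 => sub_mem (add_mem (seqA_mem F _) ((onsager F).smul_mem _ (seqA_mem F _)))
      ((onsager F).smul_mem _ (seqB_mem F _))
  | _ + 1 => sub_mem (add_mem (add_mem (seqA_mem F _) ((onsager F).smul_mem _ (seqA_mem F _)))
      ((onsager F).smul_mem _ (seqA_mem F _))) ((onsager F).smul_mem _ (seqB_mem F _))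

theorem vecZ_mem : ∀ i, vecZ F i ∈ onsager F
  | 0 => add_mem (add_mem (seqA_mem F _) ((onsager F).smul_mem _ (seqA_mem F _)))
      ((onsager F).smul_mem _ (seqB_mem F _))
  | _ + 1 => add_mem (sub_mem (add_mem (seqA_mem F _) ((onsager F).smul_mem _ (seqA_mem F _)))
      ((onsager F).smul_mem _ (seqA_mem F _))) ((onsager F).smul_mem _ (seqB_mem F _))

end Membership

/-! ### Images of the three families. -/

section Model

/-- The coefficients of the first basis family in the evaluation representation. -/
def coefX {K : Type*} [Field K] (w : K) : ℕ → K
  | 0 => 1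
  | 1 => w
  | n + 2 => (w ^ 2 - 16) * w ^ n

/-- The coefficients of the second basis family in the evaluation representation. -/
def coefY {K : Type*} [Field K] (w : K) : ℕ → K
  | 0 => (w - 4) / 2
  | n + 1 => (w ^ 2 - 16) * w ^ n / 2

/-- The coefficients of the third basis family in the evaluation representation. -/
def coefZ {K : Type*} [Field K] (w : K) : ℕ → K
  | 0 => -(w + 4) / 2
  | n + 1 => -(w ^ 2 - 16) * w ^ n / 2

variable (F K : Type*) [Field F] [CharZero F] [Field K] [CharZero K] [Algebra F K]
  [Algebra F[T;T⁻¹] K] [IsScalarTower F F[T;T⁻¹] K] [IsFractionRing F[T;T⁻¹] K]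

omit [CharZero F] [CharZero K] [Algebra F[T;T⁻¹] K] [IsScalarTower F F[T;T⁻¹] K]
  [IsFractionRing F[T;T⁻¹] K] in
theorem ofNat_smul_matrix (n : ℕ) [n.AtLeastTwo] (M : Matrix (Fin 2) (Fin 2) K) :
    (OfNat.ofNat n : F) • M = (OfNat.ofNat n : K) • M := by
  ext i j
  rw [Matrix.smul_apply, Matrix.smul_apply, Algebra.smul_def, map_ofNat, smul_eq_mul]

/-- The coefficient ring generator `2 (s + s⁻¹)`. -/
def loopTrace : K := 2 * (loopVar F K + (loopVar F K)⁻¹)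

/-- On diagonal traceless matrices, bracketing with x_12 and then with x_03 is multiplication by w =
2(s + s⁻¹); this is the source of the powers of w. -/
theorem toModel_seqA (n : ℕ) :
    toModel F K (seqA F (2 * n + 1)) = loopTrace F K ^ n •
        !![loopVar F K - (loopVar F K)⁻¹, 0; 0, (loopVar F K)⁻¹ - loopVar F K] ∧
    toModel F K (seqA F (2 * n + 2)) = loopTrace F K ^ n •
        !![0, 2 * ((loopVar F K)⁻¹ - loopVar F K); 2 * (loopVar F K - (loopVar F K)⁻¹), 0] := by
  have h := loopVar_ne_zero F K
  have even_step (n : ℕ) : seqA F (2 * n + 2) = ⁅gen F 1 2, seqA F (2 * n + 1)⁆ := by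
    rw [seqA, if_neg (by simp [parity_simps])]
  have odd_step (n : ℕ) : seqA F (2 * n + 1) = ⁅gen F 0 3, seqA F (2 * n)⁆ := by
    rw [seqA, if_pos (by simp)]
  have odd_to_even {n : ℕ} (ho : toModel F K (seqA F (2 * n + 1)) = loopTrace F K ^ n •
        !![loopVar F K - (loopVar F K)⁻¹, 0; 0, (loopVar F K)⁻¹ - loopVar F K]) :
      toModel F K (seqA F (2 * n + 2)) = loopTrace F K ^ n •
        !![0, 2 * ((loopVar F K)⁻¹ - loopVar F K); 2 * (loopVar F K - (loopVar F K)⁻¹), 0] := by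
    rw [even_step, LieHom.map_lie, ho, toModel_gen_one_two, lie_smul, lie_fin_two]
    congr 1
    ext i j
    fin_cases i <;> fin_cases j <;> simp <;> ring
  induction n with
  | zero =>
    have ho : toModel F K (seqA F (2 * 0 + 1)) = loopTrace F K ^ 0 •
        !![loopVar F K - (loopVar F K)⁻¹, 0; 0, (loopVar F K)⁻¹ - loopVar F K] := by
      rw [odd_step, LieHom.map_lie, toModel_gen_zero_three]
      change ⁅_, toModel F K (gen F 1 2)⁆ = _
      rw [toModel_gen_one_two, lie_fin_two]
      simp
    exact ⟨ho, odd_to_even ho⟩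
  | succ n ih =>
    have ho : toModel F K (seqA F (2 * (n + 1) + 1)) = loopTrace F K ^ (n + 1) •
        !![loopVar F K - (loopVar F K)⁻¹, 0; 0, (loopVar F K)⁻¹ - loopVar F K] := by
      rw [odd_step, mul_add, mul_one, LieHom.map_lie, toModel_gen_zero_three, ih.2, lie_smul,
        lie_fin_two, pow_succ, mul_smul]
      congr 1
      ext i j
      fin_cases i <;> fin_cases j <;> simp [loopTrace] <;> field_simp <;> ring
    exact ⟨ho, odd_to_even ho⟩

theorem toModel_seqB (n : ℕ) :
    toModel F K (seqB F (2 * n + 1)) = loopTrace F K ^ n •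
        !![(loopVar F K)⁻¹ - loopVar F K, 0; 0, loopVar F K - (loopVar F K)⁻¹] ∧
    toModel F K (seqB F (2 * n + 2)) = loopTrace F K ^ n •
        !![0, 2 * loopVar F K * (loopVar F K - (loopVar F K)⁻¹);
          2 * (loopVar F K)⁻¹ * ((loopVar F K)⁻¹ - loopVar F K), 0] := by
  have h := loopVar_ne_zero F K
  have even_step (n : ℕ) : seqB F (2 * n + 2) = ⁅gen F 0 3, seqB F (2 * n + 1)⁆ := by
    rw [seqB, if_neg (by simp [parity_simps])]
  have odd_step (n : ℕ) : seqB F (2 * n + 1) = ⁅gen F 1 2, seqB F (2 * n)⁆ := by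
    rw [seqB, if_pos (by simp)]
  have odd_to_even {n : ℕ} (ho : toModel F K (seqB F (2 * n + 1)) = loopTrace F K ^ n •
        !![(loopVar F K)⁻¹ - loopVar F K, 0; 0, loopVar F K - (loopVar F K)⁻¹]) :
      toModel F K (seqB F (2 * n + 2)) = loopTrace F K ^ n •
        !![0, 2 * loopVar F K * (loopVar F K - (loopVar F K)⁻¹);
          2 * (loopVar F K)⁻¹ * ((loopVar F K)⁻¹ - loopVar F K), 0] := by
    rw [even_step, LieHom.map_lie, ho, toModel_gen_zero_three, lie_smul, lie_fin_two]
    congr 1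
    ext i j
    fin_cases i <;> fin_cases j <;> simp <;> ring
  induction n with
  | zero =>
    have ho : toModel F K (seqB F (2 * 0 + 1)) = loopTrace F K ^ 0 •
        !![(loopVar F K)⁻¹ - loopVar F K, 0; 0, loopVar F K - (loopVar F K)⁻¹] := by
      rw [odd_step, LieHom.map_lie, toModel_gen_one_two]
      change ⁅_, toModel F K (gen F 0 3)⁆ = _
      rw [toModel_gen_zero_three, lie_fin_two]
      simp
    exact ⟨ho, odd_to_even ho⟩
  | succ n ih =>
    have ho : toModel F K (seqB F (2 * (n + 1) + 1)) = loopTrace F K ^ (n + 1) •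
        !![(loopVar F K)⁻¹ - loopVar F K, 0; 0, loopVar F K - (loopVar F K)⁻¹] := by
      rw [odd_step, mul_add, mul_one, LieHom.map_lie, toModel_gen_one_two, ih.2, lie_smul,
        lie_fin_two, pow_succ, mul_smul]
      congr 1
      ext i j
      fin_cases i <;> fin_cases j <;> simp [loopTrace] <;> field_simp <;> ring
    exact ⟨ho, odd_to_even ho⟩

/-- The term 4b_{2i-2} is the correction that makes the two off-diagonal entries equal. The factor
w² - 16 is 4(s - s⁻¹)². -/
theorem toModel_vecX (i : ℕ) :
    toModel F K (vecX F i) = coefX (loopTrace F K) i • toModel F K (gen F 1 2) := by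
  have h := loopVar_ne_zero F K
  rw [toModel_gen_one_two]
  match i with
  | 0 => rw [vecX, seqA, toModel_gen_one_two, coefX, one_smul]
  | 1 =>
    rw [vecX, map_add, map_smul, (toModel_seqA F K 0).2, seqB, toModel_gen_zero_three, coefX,
      ofNat_smul_matrix]
    ext i j
    fin_cases i <;> fin_cases j <;> simp [loopTrace] <;> ring
  | n + 2 =>
    have e : toModel F K (seqA F (2 * (n + 1 + 1))) = _ := (toModel_seqA F K (n + 1)).2
    rw [vecX, map_add, map_smul, e, mul_add, (toModel_seqB F K n).2,
      coefX, ofNat_smul_matrix]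
    simp only [pow_succ (loopTrace F K) n]
    generalize loopTrace F K ^ n = t
    ext i j
    fin_cases i <;> fin_cases j <;> simp [loopTrace] <;> field_simp <;> ring

/-- The denominator s - 1 of the generator is absorbed by w - 4 = 2(s - 1)²/s. In the third family,
w + 4 = 2(s + 1)²/s absorbs s + 1 in the same way. -/
theorem toModel_vecY (i : ℕ) :
    toModel F K (vecY F i) = coefY (loopTrace F K) i • toModel F K (gen F 2 3) := by
  have h := loopVar_ne_zero F K
  have h1 := sub_ne_zero.2 (loopVar_ne_one F K)
  have hY : toModel F K (gen F 2 3) = (loopVar F K - 1)⁻¹ •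
      !![1 + loopVar F K, -(2 * loopVar F K); 2, -(1 + loopVar F K)] := by
    rw [toModel_gen]
    ext i j
    fin_cases i <;> fin_cases j <;> simp [eigenMatrix, vertex] <;> field_simp
  rw [hY]
  match i with
  | 0 =>
    rw [vecY, map_sub, map_add, map_smul, map_smul, (toModel_seqA F K 0).1, seqB, seqA,
      toModel_gen_zero_three, toModel_gen_one_two, coefY]
    simp only [ofNat_smul_matrix F K]
    ext i j
    fin_cases i <;> fin_cases j <;> simp [loopTrace] <;> field_simp <;> ring
  | n + 1 =>
    rw [vecY, map_sub, map_add, map_add, map_smul, map_smul, map_smul, (toModel_seqA F K n).1,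
      (toModel_seqA F K (n + 1)).1, mul_add, (toModel_seqA F K n).2,
      (toModel_seqB F K n).2, coefY]
    simp only [ofNat_smul_matrix F K, pow_succ (loopTrace F K) n]
    generalize loopTrace F K ^ n = t
    ext i j
    fin_cases i <;> fin_cases j <;> simp [loopTrace] <;> field_simp <;> ring

theorem toModel_vecZ (i : ℕ) :
    toModel F K (vecZ F i) = coefZ (loopTrace F K) i • toModel F K (gen F 3 1) := by
  have h := loopVar_ne_zero F K
  have h1 : loopVar F K + 1 ≠ 0 := fun h => loopVar_ne_neg_one F K (eq_neg_of_add_eq_zero_left h)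
  have h2 : -1 - loopVar F K ≠ 0 := fun h => h1 (by linear_combination -h)
  have hZ : toModel F K (gen F 3 1) = (loopVar F K + 1)⁻¹ •
      !![1 - loopVar F K, -(2 * loopVar F K); -2, loopVar F K - 1] := by
    rw [toModel_gen]
    ext i j
    fin_cases i <;> fin_cases j <;> simp [eigenMatrix, vertex] <;> field_simp <;> ring
  rw [hZ]
  match i with
  | 0 =>
    rw [vecZ, map_add, map_add, map_smul, map_smul, (toModel_seqA F K 0).1, seqB, seqA,
      toModel_gen_zero_three, toModel_gen_one_two, coefZ]
    simp only [ofNat_smul_matrix F K]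
    ext i j
    fin_cases i <;> fin_cases j <;> simp [loopTrace] <;> field_simp <;> ring
  | n + 1 =>
    rw [vecZ, map_add, map_sub, map_add, map_smul, map_smul, map_smul, (toModel_seqA F K n).1,
      (toModel_seqA F K (n + 1)).1, mul_add, (toModel_seqA F K n).2,
      (toModel_seqB F K n).2, coefZ]
    simp only [ofNat_smul_matrix F K, pow_succ (loopTrace F K) n]
    generalize loopTrace F K ^ n = t
    ext i j
    fin_cases i <;> fin_cases j <;> simp [loopTrace] <;> field_simp <;> ring

end Model

/-- The field of rational functions in the loop parameter. -/
def LoopField (F : Type*) [Field F] : Type _ := FractionRing F[T;T⁻¹]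

section LoopField

variable (F : Type*) [Field F]

instance : Field (LoopField F) := inferInstanceAs (Field (FractionRing F[T;T⁻¹]))

instance : Algebra F[T;T⁻¹] (LoopField F) :=
  inferInstanceAs (Algebra F[T;T⁻¹] (FractionRing F[T;T⁻¹]))

instance : Algebra F (LoopField F) := inferInstanceAs (Algebra F (FractionRing F[T;T⁻¹]))

instance : IsScalarTower F F[T;T⁻¹] (LoopField F) :=
  inferInstanceAs (IsScalarTower F F[T;T⁻¹] (FractionRing F[T;T⁻¹]))

instance : IsFractionRing F[T;T⁻¹] (LoopField F) :=
  inferInstanceAs (IsFractionRing F[T;T⁻¹] (FractionRing F[T;T⁻¹]))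

instance [CharZero F] : CharZero (LoopField F) :=
  charZero_of_injective_algebraMap (algebraMap F (LoopField F)).injective

end LoopField

/-! ### Reduction of brackets to scalar identities. -/

section Evaluation

variable (F : Type*) (K : Type*) [Field F] [CharZero F] [Field K] [CharZero K] [Algebra F K]
  [Algebra F[T;T⁻¹] K] [IsScalarTower F F[T;T⁻¹] K] [IsFractionRing F[T;T⁻¹] K]

variable {F} in
theorem eq_of_toModel_eq {u v : Tet F} (hu : u ∈ onsager F) (hv : v ∈ onsager F)
    (h : toModel F K u = toModel F K v) : u = v := by
  refine sub_eq_zero.1 (eq_zero_of_mem_onsager_sup K 2 3 (by decide) 1 ?_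
    (Submodule.mem_sup_left (sub_mem hu hv)) (by rw [map_sub, h, sub_self]))
  simp [vertex]

-- The triangle relation for the face 1, 2, 3 turns the bracket into twice the product of the
-- coefficients times the sum of two generators. What remains is to match the coefficient of each
-- generator as a polynomial in w.
variable {F} in
theorem lie_vecX_vecY_eq (i j : ℕ) {v : Tet F} (hv : v ∈ onsager F)
    (h : toModel F K v = ((2 * coefX (loopTrace F K) i * coefY (loopTrace F K) j)) •
      (toModel F K (gen F 1 2) + toModel F K (gen F 2 3))) :
    ⁅vecX F i, vecY F j⁆ = v := by
  refine eq_of_toModel_eq K (LieSubalgebra.lie_mem _ (vecX_mem F i) (vecY_mem F j)) hv ?_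
  have t := eigenMatrix_triangle ((vertex_injective F K).ne (show (1 : Fin 4) ≠ 2 by decide))
    ((vertex_injective F K).ne (show (2 : Fin 4) ≠ 3 by decide))
  rw [h, LieHom.map_lie, toModel_vecX, toModel_vecY, smul_lie, lie_smul,
    toModel_gen, toModel_gen, t]
  module

-- The sign appears because the edges 31 and 12 are head to tail in the opposite order.
variable {F} in
theorem lie_vecX_vecZ_eq (i j : ℕ) {v : Tet F} (hv : v ∈ onsager F)
    (h : toModel F K v = (-(2 * coefX (loopTrace F K) i * coefZ (loopTrace F K) j)) •
      (toModel F K (gen F 1 2) + toModel F K (gen F 3 1))) :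
    ⁅vecX F i, vecZ F j⁆ = v := by
  refine eq_of_toModel_eq K (LieSubalgebra.lie_mem _ (vecX_mem F i) (vecZ_mem F j)) hv ?_
  have t := eigenMatrix_triangle ((vertex_injective F K).ne (show (3 : Fin 4) ≠ 1 by decide))
    ((vertex_injective F K).ne (show (1 : Fin 4) ≠ 2 by decide))
  rw [h, LieHom.map_lie, toModel_vecX, toModel_vecZ, smul_lie, lie_smul, ← lie_skew,
    toModel_gen, toModel_gen, t]
  module

variable {F} in
theorem lie_vecY_vecZ_eq (i j : ℕ) {v : Tet F} (hv : v ∈ onsager F)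
    (h : toModel F K v = ((2 * coefY (loopTrace F K) i * coefZ (loopTrace F K) j)) •
      (toModel F K (gen F 2 3) + toModel F K (gen F 3 1))) :
    ⁅vecY F i, vecZ F j⁆ = v := by
  refine eq_of_toModel_eq K (LieSubalgebra.lie_mem _ (vecY_mem F i) (vecZ_mem F j)) hv ?_
  have t := eigenMatrix_triangle ((vertex_injective F K).ne (show (2 : Fin 4) ≠ 3 by decide))
    ((vertex_injective F K).ne (show (3 : Fin 4) ≠ 1 by decide))
  rw [h, LieHom.map_lie, toModel_vecY, toModel_vecZ, smul_lie, lie_smul,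
    toModel_gen, toModel_gen, t]
  module

end Evaluation

/-! ### The bracket table. -/

section Table

variable (F : Type*) [Field F] [CharZero F]

theorem lie_vecX_self (i j : ℕ) : ⁅vecX F i, vecX F j⁆ = 0 := by
  refine eq_of_toModel_eq (LoopField F) (LieSubalgebra.lie_mem _ (vecX_mem F i) (vecX_mem F j))
    (zero_mem _) ?_
  rw [LieHom.map_lie, toModel_vecX, toModel_vecX, smul_lie, lie_smul, lie_self, smul_zero,
    smul_zero, map_zero]

theorem lie_vecY_self (i j : ℕ) : ⁅vecY F i, vecY F j⁆ = 0 := by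
  refine eq_of_toModel_eq (LoopField F) (LieSubalgebra.lie_mem _ (vecY_mem F i) (vecY_mem F j))
    (zero_mem _) ?_
  rw [LieHom.map_lie, toModel_vecY, toModel_vecY, smul_lie, lie_smul, lie_self, smul_zero,
    smul_zero, map_zero]

theorem lie_vecZ_self (i j : ℕ) : ⁅vecZ F i, vecZ F j⁆ = 0 := by
  refine eq_of_toModel_eq (LoopField F) (LieSubalgebra.lie_mem _ (vecZ_mem F i) (vecZ_mem F j))
    (zero_mem _) ?_
  rw [LieHom.map_lie, toModel_vecZ, toModel_vecZ, smul_lie, lie_smul, lie_self, smul_zero,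
    smul_zero, map_zero]

theorem lie_vecX_vecY_zero_zero :
    ⁅vecX F 0, vecY F 0⁆ =
      vecX F 1 + (2 : F) • vecY F 0 - (4 : F) • vecX F 0 := by
  apply lie_vecX_vecY_eq (LoopField F)
  · repeat' first | apply vecX_mem | apply vecY_mem | apply vecZ_mem | apply sub_mem | apply add_mem |
      apply LieSubalgebra.smul_mem
  · simp only [map_add, map_sub, map_smul, toModel_vecX, toModel_vecY, ofNat_smul_matrix F (LoopField F),
      coefX, coefY]
    module

theorem lie_vecX_vecY_one_zero :
    ⁅vecX F 1, vecY F 0⁆ =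
      vecX F 2 + (2 : F) • vecY F 1 - (4 : F) • vecX F 1 - (8 : F) • vecY F 0 + (16 : F) • vecX F 0 := by
  apply lie_vecX_vecY_eq (LoopField F)
  · repeat' first | apply vecX_mem | apply vecY_mem | apply vecZ_mem | apply sub_mem | apply add_mem |
      apply LieSubalgebra.smul_mem
  · simp only [map_add, map_sub, map_smul, toModel_vecX, toModel_vecY, ofNat_smul_matrix F (LoopField F),
      coefX, coefY]
    module

theorem lie_vecX_vecY_add_two_zero (i : ℕ) :
    ⁅vecX F (i + 2), vecY F 0⁆ =
      vecX F (i + 3) + (2 : F) • vecY F (i + 2) - (4 : F) • vecX F (i + 2) - (8 : F) • vecY F (i + 1) := by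
  apply lie_vecX_vecY_eq (LoopField F)
  · repeat' first | apply vecX_mem | apply vecY_mem | apply vecZ_mem | apply sub_mem | apply add_mem |
      apply LieSubalgebra.smul_mem
  · simp only [map_add, map_sub, map_smul, toModel_vecX, toModel_vecY, ofNat_smul_matrix F (LoopField F),
      coefX, coefY]
    module

theorem lie_vecX_vecY_zero_succ (j : ℕ) :
    ⁅vecX F 0, vecY F (j + 1)⁆ =
      vecX F (j + 2) + (2 : F) • vecY F (j + 1) := by
  apply lie_vecX_vecY_eq (LoopField F)
  · repeat' first | apply vecX_mem | apply vecY_mem | apply vecZ_mem | apply sub_mem | apply add_mem |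
      apply LieSubalgebra.smul_mem
  · simp only [map_add, map_smul, toModel_vecX, toModel_vecY, ofNat_smul_matrix F (LoopField F),
      coefX, coefY]
    module

theorem lie_vecX_vecY_one_succ (j : ℕ) :
    ⁅vecX F 1, vecY F (j + 1)⁆ =
      vecX F (j + 3) + (2 : F) • vecY F (j + 2) := by
  apply lie_vecX_vecY_eq (LoopField F)
  · repeat' first | apply vecX_mem | apply vecY_mem | apply vecZ_mem | apply sub_mem | apply add_mem |
      apply LieSubalgebra.smul_mem
  · simp only [map_add, map_smul, toModel_vecX, toModel_vecY, ofNat_smul_matrix F (LoopField F),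
      coefX, coefY]
    module

theorem lie_vecX_vecY_add_two_succ (i j : ℕ) :
    ⁅vecX F (i + 2), vecY F (j + 1)⁆ =
      vecX F (i + j + 4) + (2 : F) • vecY F (i + j + 3) - (16 : F) • vecX F (i + j + 2) - (32 : F) • vecY F (i + j + 1) := by
  apply lie_vecX_vecY_eq (LoopField F)
  · repeat' first | apply vecX_mem | apply vecY_mem | apply vecZ_mem | apply sub_mem | apply add_mem |
      apply LieSubalgebra.smul_mem
  · simp only [map_add, map_sub, map_smul, toModel_vecX, toModel_vecY, ofNat_smul_matrix F (LoopField F),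
      coefX, coefY]
    module

theorem lie_vecX_vecZ_zero_zero :
    ⁅vecX F 0, vecZ F 0⁆ =
      vecX F 1 - (2 : F) • vecZ F 0 + (4 : F) • vecX F 0 := by
  apply lie_vecX_vecZ_eq (LoopField F)
  · repeat' first | apply vecX_mem | apply vecY_mem | apply vecZ_mem | apply sub_mem | apply add_mem |
      apply LieSubalgebra.smul_mem
  · simp only [map_add, map_sub, map_smul, toModel_vecX, toModel_vecZ, ofNat_smul_matrix F (LoopField F),
      coefX, coefZ]
    module

theorem lie_vecX_vecZ_one_zero :
    ⁅vecX F 1, vecZ F 0⁆ =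
      vecX F 2 - (2 : F) • vecZ F 1 + (4 : F) • vecX F 1 - (8 : F) • vecZ F 0 + (16 : F) • vecX F 0 := by
  apply lie_vecX_vecZ_eq (LoopField F)
  · repeat' first | apply vecX_mem | apply vecY_mem | apply vecZ_mem | apply sub_mem | apply add_mem |
      apply LieSubalgebra.smul_mem
  · simp only [map_add, map_sub, map_smul, toModel_vecX, toModel_vecZ, ofNat_smul_matrix F (LoopField F),
      coefX, coefZ]
    module

theorem lie_vecX_vecZ_add_two_zero (i : ℕ) :
    ⁅vecX F (i + 2), vecZ F 0⁆ =
      vecX F (i + 3) - (2 : F) • vecZ F (i + 2) + (4 : F) • vecX F (i + 2) - (8 : F) • vecZ F (i + 1) := by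
  apply lie_vecX_vecZ_eq (LoopField F)
  · repeat' first | apply vecX_mem | apply vecY_mem | apply vecZ_mem | apply sub_mem | apply add_mem |
      apply LieSubalgebra.smul_mem
  · simp only [map_add, map_sub, map_smul, toModel_vecX, toModel_vecZ, ofNat_smul_matrix F (LoopField F),
      coefX, coefZ]
    module

theorem lie_vecX_vecZ_zero_succ (j : ℕ) :
    ⁅vecX F 0, vecZ F (j + 1)⁆ =
      vecX F (j + 2) - (2 : F) • vecZ F (j + 1) := by
  apply lie_vecX_vecZ_eq (LoopField F)
  · repeat' first | apply vecX_mem | apply vecY_mem | apply vecZ_mem | apply sub_mem | apply add_mem |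
      apply LieSubalgebra.smul_mem
  · simp only [map_sub, map_smul, toModel_vecX, toModel_vecZ, ofNat_smul_matrix F (LoopField F),
      coefX, coefZ]
    module

theorem lie_vecX_vecZ_one_succ (j : ℕ) :
    ⁅vecX F 1, vecZ F (j + 1)⁆ =
      vecX F (j + 3) - (2 : F) • vecZ F (j + 2) := by
  apply lie_vecX_vecZ_eq (LoopField F)
  · repeat' first | apply vecX_mem | apply vecY_mem | apply vecZ_mem | apply sub_mem | apply add_mem |
      apply LieSubalgebra.smul_mem
  · simp only [map_sub, map_smul, toModel_vecX, toModel_vecZ, ofNat_smul_matrix F (LoopField F),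
      coefX, coefZ]
    module

theorem lie_vecX_vecZ_add_two_succ (i j : ℕ) :
    ⁅vecX F (i + 2), vecZ F (j + 1)⁆ =
      vecX F (i + j + 4) - (2 : F) • vecZ F (i + j + 3) - (16 : F) • vecX F (i + j + 2) + (32 : F) • vecZ F (i + j + 1) := by
  apply lie_vecX_vecZ_eq (LoopField F)
  · repeat' first | apply vecX_mem | apply vecY_mem | apply vecZ_mem | apply sub_mem | apply add_mem |
      apply LieSubalgebra.smul_mem
  · simp only [map_add, map_sub, map_smul, toModel_vecX, toModel_vecZ, ofNat_smul_matrix F (LoopField F),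
      coefX, coefZ]
    module

theorem lie_vecY_vecZ_zero_zero :
    ⁅vecY F 0, vecZ F 0⁆ =
      vecZ F 1 - vecY F 1 := by
  apply lie_vecY_vecZ_eq (LoopField F)
  · exact sub_mem (vecZ_mem F 1) (vecY_mem F 1)
  · simp only [map_sub, toModel_vecY, toModel_vecZ, coefY, coefZ]
    module

theorem lie_vecY_vecZ_succ_zero (i : ℕ) :
    ⁅vecY F (i + 1), vecZ F 0⁆ =
      vecZ F (i + 2) - vecY F (i + 2) + (4 : F) • vecZ F (i + 1) - (4 : F) • vecY F (i + 1) := by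
  apply lie_vecY_vecZ_eq (LoopField F)
  · repeat' first | apply vecX_mem | apply vecY_mem | apply vecZ_mem | apply sub_mem | apply add_mem |
      apply LieSubalgebra.smul_mem
  · simp only [map_add, map_sub, map_smul, toModel_vecY, toModel_vecZ, ofNat_smul_matrix F (LoopField F),
      coefY, coefZ]
    module

theorem lie_vecY_vecZ_zero_succ (j : ℕ) :
    ⁅vecY F 0, vecZ F (j + 1)⁆ =
      vecZ F (j + 2) - vecY F (j + 2) - (4 : F) • vecZ F (j + 1) + (4 : F) • vecY F (j + 1) := by
  apply lie_vecY_vecZ_eq (LoopField F)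
  · repeat' first | apply vecX_mem | apply vecY_mem | apply vecZ_mem | apply sub_mem | apply add_mem |
      apply LieSubalgebra.smul_mem
  · simp only [map_add, map_sub, map_smul, toModel_vecY, toModel_vecZ, ofNat_smul_matrix F (LoopField F),
      coefY, coefZ]
    module

theorem lie_vecY_vecZ_succ_succ (i j : ℕ) :
    ⁅vecY F (i + 1), vecZ F (j + 1)⁆ =
      vecZ F (i + j + 3) - vecY F (i + j + 3) - (16 : F) • vecZ F (i + j + 1) + (16 : F) • vecY F (i + j + 1) := by
  apply lie_vecY_vecZ_eq (LoopField F)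
  · repeat' first | apply vecX_mem | apply vecY_mem | apply vecZ_mem | apply sub_mem | apply add_mem |
      apply LieSubalgebra.smul_mem
  · simp only [map_add, map_sub, map_smul, toModel_vecY, toModel_vecZ, ofNat_smul_matrix F (LoopField F),
      coefY, coefZ]
    module

theorem gen_zero_three_eq : gen F 0 3 = (4 : F)⁻¹ • (vecZ F 0 - vecY F 0) := by
  have h : vecZ F 0 - vecY F 0 = (4 : F) • gen F 0 3 := by
    rw [vecZ, vecY, seqB]
    module
  rw [h, inv_smul_smul₀ (by norm_num)]

end Table

/-! ### Likeness of the three families. -/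

section Like

variable (F : Type*) [Field F]

-- The hypothesis lists the four ways in which two edges share exactly one vertex; skew symmetry
-- brings each to the head-to-tail form of the triangle relation.
variable {F} in
theorem lie_gen_mem {W : Submodule F (Tet F)} {i j p q : Fin 4} (hij : i ≠ j) (hpq : p ≠ q)
    (h : (j = p ∧ i ≠ q) ∨ (i = q ∧ j ≠ p) ∨ (j = q ∧ i ≠ p) ∨ (i = p ∧ j ≠ q))
    (hu : gen F i j hij ∈ W) (hv : gen F p q hpq ∈ W) : ⁅gen F i j hij, gen F p q hpq⁆ ∈ W := by
  have key {a b c : Fin 4} (ab : a ≠ b) (bc : b ≠ c) (ac : a ≠ c) (h1 : gen F a b ab ∈ W)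
      (h2 : gen F b c bc ∈ W) : ⁅gen F a b ab, gen F b c bc⁆ ∈ W := by
    rw [gen_triangle F a b c ab ac bc]
    exact W.add_mem (W.smul_mem _ h1) (W.smul_mem _ h2)
  have hu' : gen F j i hij.symm ∈ W := by rw [gen_skew]; exact W.neg_mem hu
  have hv' : gen F q p hpq.symm ∈ W := by rw [gen_skew]; exact W.neg_mem hv
  rcases h with ⟨rfl, h⟩ | ⟨rfl, h⟩ | ⟨rfl, h⟩ | ⟨rfl, h⟩
  · exact key hij hpq h hu hv
  · rw [← lie_skew]
    exact W.neg_mem (key hpq hij h.symm hv hu)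
  · rw [gen_skew F p, lie_neg]
    exact W.neg_mem (key hij hpq.symm h hu hv')
  · rw [gen_skew F i, neg_lie]
    exact W.neg_mem (key hij.symm hpq h hu' hv)

/-- Only the opposite edge and its reversal occur in the definition. The reversal changes both sides
by the same sign, since x_hk enters three times on the left and once on the right. -/
theorem isLike_of_dolanGrady {i j h k : Fin 4} (hij : i ≠ j) (hk : h ≠ k) (hi : h ≠ i) (hj : h ≠ j)
    (ki : k ≠ i) (kj : k ≠ j) {ξ : Tet F} (h0 : ⁅gen F i j hij, ξ⁆ = 0)
    (h1 : ⁅gen F h k hk, ⁅gen F h k hk, ⁅gen F h k hk, ξ⁆⁆⁆ = (4 : F) • ⁅gen F h k hk, ξ⁆) :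
    IsLike F i j hij ξ := by
  refine ⟨h0, fun h' k' hk' hi' hj' ki' kj' => ?_⟩
  have : (h' = h ∧ k' = k) ∨ (h' = k ∧ k' = h) := by omega
  rcases this with ⟨rfl, rfl⟩ | ⟨rfl, rfl⟩
  · exact h1
  · rw [gen_skew F h' k']
    simp only [neg_lie, lie_neg, neg_neg, smul_neg, h1]

variable [CharZero F]

/-- Identities between brackets of one further generator with an element of the Onsager subalgebra
may be checked in the evaluation representation. -/
theorem lie_gen_of_toModel (i j : Fin 4) (hij : i ≠ j) (c : Fˣ)
    (h : vertex F (LoopField F) j - vertex F (LoopField F) i =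
      loopVar F (LoopField F) - algebraMap F (LoopField F) c)
    (h12 : (j = 1 ∧ i ≠ 2) ∨ (i = 2 ∧ j ≠ 1) ∨ (j = 2 ∧ i ≠ 1) ∨ (i = 1 ∧ j ≠ 2))
    (h03 : (j = 0 ∧ i ≠ 3) ∨ (i = 3 ∧ j ≠ 0) ∨ (j = 3 ∧ i ≠ 0) ∨ (i = 0 ∧ j ≠ 3))
    {v : Tet F} (hv : v ∈ onsager F) :
    (⁅toModel F (LoopField F) (gen F i j hij), toModel F (LoopField F) v⁆ = 0 →
      ⁅gen F i j hij, v⁆ = 0) ∧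
    (⁅toModel F (LoopField F) (gen F i j hij), ⁅toModel F (LoopField F) (gen F i j hij),
      ⁅toModel F (LoopField F) (gen F i j hij), toModel F (LoopField F) v⁆⁆⁆ =
        (4 : F) • ⁅toModel F (LoopField F) (gen F i j hij), toModel F (LoopField F) v⁆ →
      ⁅gen F i j hij, ⁅gen F i j hij, ⁅gen F i j hij, v⁆⁆⁆ = (4 : F) • ⁅gen F i j hij, v⁆) := by
  have stable {v : Tet F} (hv : v ∈ (onsager F).toSubmodule ⊔ Submodule.span F {gen F i j hij}) :
      ⁅gen F i j hij, v⁆ ∈ (onsager F).toSubmodule ⊔ Submodule.span F {gen F i j hij} := by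
    refine lie_mem_lieSpan_sup ?_ hv
    have hu := Submodule.mem_sup_right (S := (onsager F).toSubmodule)
      (Submodule.mem_span_singleton_self (R := F) (gen F i j hij))
    rintro _ (rfl | rfl)
    · exact lie_gen_mem hij _ h12 hu (Submodule.mem_sup_left (gen_one_two_mem F))
    · exact lie_gen_mem hij _ h03 hu (Submodule.mem_sup_left (gen_zero_three_mem F))
  have s1 := stable (Submodule.mem_sup_left hv)
  refine ⟨fun e => eq_zero_of_mem_onsager_sup (LoopField F) i j hij c h s1 ?_, fun e =>
    sub_eq_zero.1 (eq_zero_of_mem_onsager_sup (LoopField F) i j hij c h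
      (Submodule.sub_mem _ (stable (stable s1)) (Submodule.smul_mem _ _ s1)) ?_)⟩
  · rw [LieHom.map_lie, e]
  · rw [map_sub, map_smul, LieHom.map_lie, LieHom.map_lie, LieHom.map_lie, e, sub_self]

theorem toModel_gen_dolanGrady (i j p q : Fin 4) (hij : i ≠ j) (hpq : p ≠ q) (t : LoopField F) :
    ⁅toModel F (LoopField F) (gen F i j hij), ⁅toModel F (LoopField F) (gen F i j hij),
      ⁅toModel F (LoopField F) (gen F i j hij), t • toModel F (LoopField F) (gen F p q hpq)⁆⁆⁆ =
    (4 : F) • ⁅toModel F (LoopField F) (gen F i j hij),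
      t • toModel F (LoopField F) (gen F p q hpq)⁆ := by
  simp only [toModel_gen, lie_smul]
  rw [eigenMatrix_dolanGrady ((vertex_injective F _).ne hij) ((vertex_injective F _).ne hpq),
    ofNat_smul_matrix F (LoopField F), smul_comm]

/-- Both x_12 and the opposite x_03 lie in 𝒪, so no extension of 𝒪 is needed for this family. -/
theorem vecX_isLike (i : ℕ) : IsLike F 1 2 (by decide) (vecX F i) := by
  refine isLike_of_dolanGrady F (h := 0) (k := 3) _ (by decide) (by decide) (by decide)
    (by decide) (by decide) (lie_vecX_self F 0 i) (eq_of_toModel_eq (LoopField F) ?_ ?_ ?_)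
  · have := gen_zero_three_mem F
    exact LieSubalgebra.lie_mem _ this (LieSubalgebra.lie_mem _ this
      (LieSubalgebra.lie_mem _ this (vecX_mem F i)))
  · exact LieSubalgebra.smul_mem _ _
      (LieSubalgebra.lie_mem _ (gen_zero_three_mem F) (vecX_mem F i))
  · rw [map_smul, LieHom.map_lie, LieHom.map_lie, LieHom.map_lie, toModel_vecX]
    exact toModel_gen_dolanGrady F 0 3 1 2 _ _ _

theorem vecY_isLike (i : ℕ) : IsLike F 2 3 (by decide) (vecY F i) := by
  refine isLike_of_dolanGrady F (h := 0) (k := 1) _ (by decide) (by decide) (by decide)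
    (by decide) (by decide)
    ((lie_gen_of_toModel F 2 3 _ 1 (by simp [vertex]) (by decide) (by decide)
      (vecY_mem F i)).1 ?_)
    ((lie_gen_of_toModel F 0 1 _ 1 ?_ (by decide) (by decide) (vecY_mem F i)).2 ?_)
  · rw [toModel_vecY, lie_smul, lie_self, smul_zero]
  · simp [vertex]
    ring
  · rw [toModel_vecY]
    exact toModel_gen_dolanGrady F 0 1 2 3 _ _ _

theorem vecZ_isLike (i : ℕ) : IsLike F 3 1 (by decide) (vecZ F i) := by
  -- The edge is reversed so that the vertex difference is s - (-1), the form s - c required for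
  -- faithfulness.
  have h13 : ⁅gen F 1 3, vecZ F i⁆ = 0 := by
    refine (lie_gen_of_toModel F 1 3 _ (-1) (by simp [vertex]) (by decide) (by decide)
      (vecZ_mem F i)).1 ?_
    rw [toModel_vecZ, gen_skew F 1 3, map_neg, neg_lie, lie_smul, lie_self, smul_zero, neg_zero]
  refine isLike_of_dolanGrady F (h := 0) (k := 2) _ (by decide) (by decide) (by decide)
    (by decide) (by decide) ?_
    ((lie_gen_of_toModel F 0 2 _ (-1) ?_ (by decide) (by decide) (vecZ_mem F i)).2 ?_)
  · rw [gen_skew F 3 1, neg_lie, h13, neg_zero]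
  · simp [vertex]
    ring
  · rw [toModel_vecZ]
    exact toModel_gen_dolanGrady F 0 2 3 1 _ _ _

end Like

/-! ### Transcendence of the loop parameter and of w. -/

section Independence

open Polynomial in
theorem transcendental_loopVar (F K : Type*) [Field F] [Field K] [Algebra F K]
    [Algebra F[T;T⁻¹] K] [IsScalarTower F F[T;T⁻¹] K] [IsFractionRing F[T;T⁻¹] K] :
    Transcendental F (loopVar F K) := by
  rw [transcendental_iff_injective]
  have : aeval (loopVar F K) = (IsScalarTower.toAlgHom F F[T;T⁻¹] K).comp toLaurentAlg := by
    ext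
    simp [loopVar]
  rw [this]
  exact (IsFractionRing.injective F[T;T⁻¹] K).comp toLaurent_injective

open Polynomial in
theorem transcendental_loopTrace (F K : Type*) [Field F] [CharZero F] [Field K] [CharZero K]
    [Algebra F K] [Algebra F[T;T⁻¹] K] [IsScalarTower F F[T;T⁻¹] K] [IsFractionRing F[T;T⁻¹] K] :
    Transcendental F (loopTrace F K) := by
  intro hw
  apply transcendental_loopVar F K
  have h := loopVar_ne_zero F K
  let E := algebraicClosure F K
  let w : E := ⟨loopTrace F K, mem_algebraicClosure_iff.2 hw⟩
  -- Since w = 2(s + s⁻¹), the parameter s is a root of 2X² - wX + 2. If w were algebraic over F,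
  -- then s would be too.
  have : IsAlgebraic E (loopVar F K) := by
    refine ⟨(2 * X ^ 2 - Polynomial.C w * X + 2 : E[X]), ?_, ?_⟩
    · intro h0
      have := congrArg (fun p => p.coeff 0) h0
      simp at this
    · have h2 : aeval (loopVar F K) (2 : E[X]) = 2 := map_ofNat _ 2
      have hC : algebraMap E K w = loopTrace F K := rfl
      rw [map_add, map_sub, map_mul, map_mul, map_pow, aeval_X, aeval_C, h2, hC, loopTrace]
      field_simp
      ring
  exact this.restrictScalars F

end Independence

/-! ### Linear independence of the three families. -/

section Independence

/-- The polynomials `1, (X ^ 2 - 16) X ^ n` interleaved with `X`. -/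
def sequenceX (F : Type*) [Field F] : Polynomial.Sequence F where
  elems'
    | 0 => 1
    | 1 => Polynomial.X
    | n + 2 => (Polynomial.X ^ 2 - Polynomial.C 16) * Polynomial.X ^ n
  degree_eq' i := by
    match i with
    | 0 => simp
    | 1 => simp
    | n + 2 =>
      rw [Polynomial.degree_mul, Polynomial.degree_X_pow_sub_C two_pos, Polynomial.degree_X_pow,
        add_comm]
      norm_cast

/-- The polynomials `1` and `(X + c) X ^ n`. -/
def sequenceShift {F : Type*} [Field F] (c : F) : Polynomial.Sequence F where
  elems'
    | 0 => 1
    | n + 1 => (Polynomial.X + Polynomial.C c) * Polynomial.X ^ n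
  degree_eq' i := by
    match i with
    | 0 => simp
    | n + 1 =>
      rw [Polynomial.degree_mul, Polynomial.degree_X_add_C, Polynomial.degree_X_pow, add_comm]
      norm_cast

variable (F K : Type*) [Field F] [CharZero F] [Field K] [CharZero K] [Algebra F K]
  [Algebra F[T;T⁻¹] K] [IsScalarTower F F[T;T⁻¹] K] [IsFractionRing F[T;T⁻¹] K]

theorem loopTrace_ne_algebraMap (c : F) : loopTrace F K ≠ algebraMap F K c := by
  intro h
  apply transcendental_loopTrace F K
  rw [h]
  exact isAlgebraic_algebraMap c

/-- Polynomials with one of each degree are independent; evaluation at the transcendental w and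
multiplication by t are both injective. -/
theorem linearIndependent_mul_aeval (S : Polynomial.Sequence F) {t : K} (ht : t ≠ 0) :
    LinearIndependent F fun i => t * Polynomial.aeval (loopTrace F K) (S i) := by
  refine S.linearIndependent.map_injOn (LinearMap.mulLeft F t ∘ₗ
    (Polynomial.aeval (loopTrace F K)).toLinearMap) (Function.Injective.injOn ?_)
  exact (mul_right_injective₀ ht).comp
    (transcendental_iff_injective.1 (transcendental_loopTrace F K))

theorem linearIndependent_coefX : LinearIndependent F (coefX (loopTrace F K)) := by
  convert linearIndependent_mul_aeval F K (sequenceX F) one_ne_zero using 1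
  ext i
  match i with
  | 0 => simp [coefX, sequenceX]
  | 1 => simp [coefX, sequenceX]
  | n + 2 =>
    have : algebraMap F K 16 = 16 := map_ofNat _ 16
    simp [coefX, sequenceX, this]

theorem linearIndependent_coefY : LinearIndependent F (coefY (loopTrace F K)) := by
  have e : algebraMap F K 4 = 4 := map_ofNat _ 4
  have h : (loopTrace F K - 4) / 2 ≠ 0 :=
    div_ne_zero (sub_ne_zero.2 (e ▸ loopTrace_ne_algebraMap F K 4)) two_ne_zero
  -- With (w - 4)/2 pulled out, w² - 16 leaves w + 4, so the remaining factors are 1 and (w + 4)wⁿ.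
  convert linearIndependent_mul_aeval F K (sequenceShift (4 : F)) h using 1
  ext i
  match i with
  | 0 => simp [coefY, sequenceShift]
  | n + 1 =>
    simp [coefY, sequenceShift, e]
    ring

theorem linearIndependent_coefZ : LinearIndependent F (coefZ (loopTrace F K)) := by
  have e : algebraMap F K (-4) = -4 := by rw [map_neg, map_ofNat]
  have h : -(loopTrace F K + 4) / 2 ≠ 0 := by
    refine div_ne_zero (neg_ne_zero.2 fun h => ?_) two_ne_zero
    exact loopTrace_ne_algebraMap F K (-4) (by rw [e]; exact eq_neg_of_add_eq_zero_left h)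
  convert linearIndependent_mul_aeval F K (sequenceShift (-4 : F)) h using 1
  ext i
  match i with
  | 0 => simp [coefZ, sequenceShift]
  | n + 1 =>
    have e' : algebraMap F K 4 = 4 := map_ofNat _ 4
    simp [coefZ, sequenceShift, e']
    ring

/-- The three standard matrices of a face are linearly independent. -/
theorem smul_face_eq_zero {a b c : K} (h : a • toModel F K (gen F 1 2) +
    (b • toModel F K (gen F 2 3) + c • toModel F K (gen F 3 1)) = 0) : a = 0 ∧ b = 0 ∧ c = 0 := by
  have h1 := sub_ne_zero.2 (loopVar_ne_one F K)
  have h2 : -1 - loopVar F K ≠ 0 := fun h =>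
    loopVar_ne_neg_one F K (by linear_combination -h)
  rw [toModel_gen_one_two, toModel_gen, toModel_gen] at h
  have e00 := congrFun (congrFun h 0) 0
  have e01 := congrFun (congrFun h 0) 1
  have e10 := congrFun (congrFun h 1) 0
  simp only [eigenMatrix, vertex] at e00 e01 e10
  simp at e00 e01 e10
  -- Rescaling b and c by the denominators of the two matrices leaves a polynomial linear system.
  obtain ⟨b', rfl⟩ : ∃ b', b = b' * (loopVar F K - 1) := ⟨b / _, (div_mul_cancel₀ b h1).symm⟩
  obtain ⟨c', rfl⟩ : ∃ c', c = c' * (-1 - loopVar F K) := ⟨c / _, (div_mul_cancel₀ c h2).symm⟩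
  field_simp at e00 e01 e10
  have hb : b' * (-1 - loopVar F K) = 0 := by linear_combination (e01 - e10 - 2 * e00) / 4
  obtain rfl := (mul_eq_zero.1 hb).resolve_right h2
  have hc : c' * (loopVar F K - 1) = 0 := by linear_combination e00
  obtain rfl := (mul_eq_zero.1 hc).resolve_right h1
  simpa using e10

/-- By independence of the face matrices, K³ embeds F-linearly in the matrices, and the families
come from three different coordinates; each is therefore handled on its own. -/
theorem linearIndependent_vec :
    LinearIndependent F (Sum.elim (vecX F) (Sum.elim (vecY F) (vecZ F))) := by
  set K := LoopField F
  let Φ : K × K × K →ₗ[F] Matrix (Fin 2) (Fin 2) K :=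
    ((LinearMap.toSpanSingleton K _ (toModel F K (gen F 1 2))).coprod
      ((LinearMap.toSpanSingleton K _ (toModel F K (gen F 2 3))).coprod
        (LinearMap.toSpanSingleton K _ (toModel F K (gen F 3 1))))).restrictScalars F
  have hΦ : Function.Injective Φ := by
    rw [injective_iff_map_eq_zero]
    rintro ⟨a, b, c⟩ h
    obtain ⟨rfl, rfl, rfl⟩ := smul_face_eq_zero F K h
    rfl
  refine LinearIndependent.of_comp (toModel F K : Tet F →ₗ[F] Matrix (Fin 2) (Fin 2) K) ?_
  have li := (linearIndependent_inl_union_inr' (linearIndependent_coefX F K)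
    (linearIndependent_inl_union_inr' (linearIndependent_coefY F K)
      (linearIndependent_coefZ F K))).map_injOn Φ hΦ.injOn
  suffices e : Φ ∘ Sum.elim (LinearMap.inl F K (K × K) ∘ coefX (loopTrace F K))
      (LinearMap.inr F K (K × K) ∘ Sum.elim (LinearMap.inl F K K ∘ coefY (loopTrace F K))
        (LinearMap.inr F K K ∘ coefZ (loopTrace F K))) =
      toModel F K ∘ Sum.elim (vecX F) (Sum.elim (vecY F) (vecZ F)) by
    rw [e] at li
    exact li
  ext1 i
  rcases i with i | i | i
  · simp [Φ, toModel_vecX]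
  · simp [Φ, toModel_vecY]
  · simp [Φ, toModel_vecZ]

end Independence

/-! ### Spanning, and the basis. -/

section Span

variable (F : Type*) [Field F] [CharZero F]

/-- The span contains x_12 = x_0 and x_03 = (z_0 - y_0)/4, and the table shows that it is stable
under bracketing with both. That is enough to contain the subalgebra they generate. -/
theorem span_vec : Submodule.span F (Set.range (Sum.elim (vecX F) (Sum.elim (vecY F) (vecZ F)))) =
    (onsager F).toSubmodule := by
  set W := Submodule.span F (Set.range (Sum.elim (vecX F) (Sum.elim (vecY F) (vecZ F))))
  have hX (i : ℕ) : vecX F i ∈ W := Submodule.subset_span ⟨Sum.inl i, rfl⟩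
  have hY (i : ℕ) : vecY F i ∈ W := Submodule.subset_span ⟨Sum.inr (Sum.inl i), rfl⟩
  have hZ (i : ℕ) : vecZ F i ∈ W := Submodule.subset_span ⟨Sum.inr (Sum.inr i), rfl⟩
  have closed {u : Tet F} (h : ∀ i, ⁅u, vecX F i⁆ ∈ W ∧ ⁅u, vecY F i⁆ ∈ W ∧ ⁅u, vecZ F i⁆ ∈ W)
      (v : Tet F) (hv : v ∈ W) : ⁅u, v⁆ ∈ W := by
    suffices W ≤ W.comap (LieModule.toEnd F (Tet F) (Tet F) u : Tet F →ₗ[F] Tet F) from this hv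
    rw [Submodule.span_le]
    rintro _ ⟨i | i | i, rfl⟩
    · exact (h i).1
    · exact (h i).2.1
    · exact (h i).2.2
  have hXY (i j : ℕ) : ⁅vecX F i, vecY F j⁆ ∈ W := by
    match i, j with
    | 0, 0 =>
      rw [lie_vecX_vecY_zero_zero]
      with_reducible repeat' (first | apply hX | apply hY | apply sub_mem | apply add_mem |
        apply W.smul_mem)
    | 1, 0 =>
      rw [lie_vecX_vecY_one_zero]
      with_reducible repeat' (first | apply hX | apply hY | apply sub_mem | apply add_mem |
        apply W.smul_mem)
    | i + 2, 0 =>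
      rw [lie_vecX_vecY_add_two_zero]
      with_reducible repeat' (first | apply hX | apply hY | apply sub_mem | apply add_mem |
        apply W.smul_mem)
    | 0, j + 1 =>
      rw [lie_vecX_vecY_zero_succ]
      with_reducible repeat' (first | apply hX | apply hY | apply sub_mem | apply add_mem |
        apply W.smul_mem)
    | 1, j + 1 =>
      rw [lie_vecX_vecY_one_succ]
      with_reducible repeat' (first | apply hX | apply hY | apply sub_mem | apply add_mem |
        apply W.smul_mem)
    | i + 2, j + 1 =>
      rw [lie_vecX_vecY_add_two_succ]
      with_reducible repeat' (first | apply hX | apply hY | apply sub_mem | apply add_mem |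
        apply W.smul_mem)
  have hXZ (i j : ℕ) : ⁅vecX F i, vecZ F j⁆ ∈ W := by
    match i, j with
    | 0, 0 =>
      rw [lie_vecX_vecZ_zero_zero]
      with_reducible repeat' (first | apply hX | apply hZ | apply sub_mem | apply add_mem |
        apply W.smul_mem)
    | 1, 0 =>
      rw [lie_vecX_vecZ_one_zero]
      with_reducible repeat' (first | apply hX | apply hZ | apply sub_mem | apply add_mem |
        apply W.smul_mem)
    | i + 2, 0 =>
      rw [lie_vecX_vecZ_add_two_zero]
      with_reducible repeat' (first | apply hX | apply hZ | apply sub_mem | apply add_mem |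
        apply W.smul_mem)
    | 0, j + 1 =>
      rw [lie_vecX_vecZ_zero_succ]
      with_reducible repeat' (first | apply hX | apply hZ | apply sub_mem | apply add_mem |
        apply W.smul_mem)
    | 1, j + 1 =>
      rw [lie_vecX_vecZ_one_succ]
      with_reducible repeat' (first | apply hX | apply hZ | apply sub_mem | apply add_mem |
        apply W.smul_mem)
    | i + 2, j + 1 =>
      rw [lie_vecX_vecZ_add_two_succ]
      with_reducible repeat' (first | apply hX | apply hZ | apply sub_mem | apply add_mem |
        apply W.smul_mem)
  have hYZ (i j : ℕ) : ⁅vecY F i, vecZ F j⁆ ∈ W := by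
    match i, j with
    | 0, 0 =>
      rw [lie_vecY_vecZ_zero_zero]
      exact W.sub_mem (hZ 1) (hY 1)
    | i + 1, 0 =>
      rw [lie_vecY_vecZ_succ_zero]
      with_reducible repeat' (first | apply hY | apply hZ | apply sub_mem | apply add_mem |
        apply W.smul_mem)
    | 0, j + 1 =>
      rw [lie_vecY_vecZ_zero_succ]
      with_reducible repeat' (first | apply hY | apply hZ | apply sub_mem | apply add_mem |
        apply W.smul_mem)
    | i + 1, j + 1 =>
      rw [lie_vecY_vecZ_succ_succ]
      with_reducible repeat' (first | apply hY | apply hZ | apply sub_mem | apply add_mem |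
        apply W.smul_mem)
  have swap {u v : Tet F} (h : ⁅u, v⁆ ∈ W) : ⁅v, u⁆ ∈ W := by
    rw [← lie_skew]
    exact W.neg_mem h
  have h12 : gen F 1 2 = vecX F 0 := rfl
  apply le_antisymm
  · rw [Submodule.span_le]
    rintro _ ⟨i | i | i, rfl⟩
    · exact vecX_mem F i
    · exact vecY_mem F i
    · exact vecZ_mem F i
  · intro u hu
    refine (lieSpan_le_of_lie_mem ?_ ?_ (show u ∈ LieSubalgebra.lieSpan F _ _ from hu)).1
    · rintro _ (rfl | rfl)
      · exact hX 0
      · rw [gen_zero_three_eq]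
        exact W.smul_mem _ (W.sub_mem (hZ 0) (hY 0))
    · rintro _ (rfl | rfl)
      · refine closed fun i => ⟨?_, hXY 0 i, hXZ 0 i⟩
        rw [h12, lie_vecX_self]
        exact W.zero_mem
      · refine closed fun i => ?_
        simp only [gen_zero_three_eq, smul_lie, sub_lie, lie_vecY_self, lie_vecZ_self]
        exact ⟨W.smul_mem _ (W.sub_mem (swap (hXZ _ _)) (swap (hXY _ _))),
          W.smul_mem _ (W.sub_mem (swap (hYZ _ _)) W.zero_mem),
          W.smul_mem _ (W.sub_mem W.zero_mem (hYZ _ _))⟩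

/-- The basis of the Onsager subalgebra consisting of the three families. -/
def onsagerBasis : Module.Basis (ℕ ⊕ ℕ ⊕ ℕ) F (onsager F) :=
  (Module.Basis.span (linearIndependent_vec F)).map (LinearEquiv.ofEq _ _ (span_vec F))

theorem onsagerBasis_apply (i : ℕ ⊕ ℕ ⊕ ℕ) :
    (onsagerBasis F i : Tet F) = Sum.elim (vecX F) (Sum.elim (vecY F) (vecZ F)) i := by
  rw [onsagerBasis, Module.Basis.map_apply, LinearEquiv.coe_ofEq_apply, Module.Basis.span_apply]

end Span

end Tetrahedron

end

/-! ### The main theorem. -/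

theorem mainTheorem4 (F : Type*) [Field F] [CharZero F] :
    -- the three families form a basis of the Onsager subalgebra
    (∃ B : Module.Basis (ℕ ⊕ ℕ ⊕ ℕ) F (Tetrahedron.onsager F),
      (∀ i : ℕ, (B (Sum.inl i) : Tetrahedron.Tet F) = Tetrahedron.vecX F i) ∧
      (∀ i : ℕ, (B (Sum.inr (Sum.inl i)) : Tetrahedron.Tet F) = Tetrahedron.vecY F i) ∧
      (∀ i : ℕ, (B (Sum.inr (Sum.inr i)) : Tetrahedron.Tet F) = Tetrahedron.vecZ F i)) ∧
    -- they consist of like elements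
    (∀ i : ℕ, Tetrahedron.IsLike F 1 2 (by decide) (Tetrahedron.vecX F i)) ∧
    (∀ i : ℕ, Tetrahedron.IsLike F 2 3 (by decide) (Tetrahedron.vecY F i)) ∧
    (∀ i : ℕ, Tetrahedron.IsLike F 3 1 (by decide) (Tetrahedron.vecZ F i)) ∧
    -- the standard generators
    Tetrahedron.gen F 1 2 = Tetrahedron.vecX F 0 ∧
    Tetrahedron.gen F 0 3 = (4 : F)⁻¹ • (Tetrahedron.vecZ F 0 - Tetrahedron.vecY F 0) ∧
    -- brackets inside one family
    (∀ i j : ℕ, ⁅Tetrahedron.vecX F i, Tetrahedron.vecX F j⁆ = 0) ∧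
    (∀ i j : ℕ, ⁅Tetrahedron.vecY F i, Tetrahedron.vecY F j⁆ = 0) ∧
    (∀ i j : ℕ, ⁅Tetrahedron.vecZ F i, Tetrahedron.vecZ F j⁆ = 0) ∧
    -- brackets of the first family with the second
    (⁅Tetrahedron.vecX F 0, Tetrahedron.vecY F 0⁆ =
      Tetrahedron.vecX F 1 + (2 : F) • Tetrahedron.vecY F 0 - (4 : F) • Tetrahedron.vecX F 0) ∧
    (⁅Tetrahedron.vecX F 1, Tetrahedron.vecY F 0⁆ =
      Tetrahedron.vecX F 2 + (2 : F) • Tetrahedron.vecY F 1 - (4 : F) • Tetrahedron.vecX F 1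
        - (8 : F) • Tetrahedron.vecY F 0 + (16 : F) • Tetrahedron.vecX F 0) ∧
    (∀ i : ℕ, 2 ≤ i → ⁅Tetrahedron.vecX F i, Tetrahedron.vecY F 0⁆ =
      Tetrahedron.vecX F (i + 1) + (2 : F) • Tetrahedron.vecY F i
        - (4 : F) • Tetrahedron.vecX F i - (8 : F) • Tetrahedron.vecY F (i - 1)) ∧
    (∀ i j : ℕ, i ≤ 1 → 1 ≤ j → ⁅Tetrahedron.vecX F i, Tetrahedron.vecY F j⁆ =
      Tetrahedron.vecX F (i + j + 1) + (2 : F) • Tetrahedron.vecY F (i + j)) ∧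
    (∀ i j : ℕ, 2 ≤ i → 1 ≤ j → ⁅Tetrahedron.vecX F i, Tetrahedron.vecY F j⁆ =
      Tetrahedron.vecX F (i + j + 1) + (2 : F) • Tetrahedron.vecY F (i + j)
        - (16 : F) • Tetrahedron.vecX F (i + j - 1)
        - (32 : F) • Tetrahedron.vecY F (i + j - 2)) ∧
    -- brackets of the first family with the third
    (⁅Tetrahedron.vecX F 0, Tetrahedron.vecZ F 0⁆ =
      Tetrahedron.vecX F 1 - (2 : F) • Tetrahedron.vecZ F 0 + (4 : F) • Tetrahedron.vecX F 0) ∧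
    (⁅Tetrahedron.vecX F 1, Tetrahedron.vecZ F 0⁆ =
      Tetrahedron.vecX F 2 - (2 : F) • Tetrahedron.vecZ F 1 + (4 : F) • Tetrahedron.vecX F 1
        - (8 : F) • Tetrahedron.vecZ F 0 + (16 : F) • Tetrahedron.vecX F 0) ∧
    (∀ i : ℕ, 2 ≤ i → ⁅Tetrahedron.vecX F i, Tetrahedron.vecZ F 0⁆ =
      Tetrahedron.vecX F (i + 1) - (2 : F) • Tetrahedron.vecZ F i
        + (4 : F) • Tetrahedron.vecX F i - (8 : F) • Tetrahedron.vecZ F (i - 1)) ∧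
    (∀ i j : ℕ, i ≤ 1 → 1 ≤ j → ⁅Tetrahedron.vecX F i, Tetrahedron.vecZ F j⁆ =
      Tetrahedron.vecX F (i + j + 1) - (2 : F) • Tetrahedron.vecZ F (i + j)) ∧
    (∀ i j : ℕ, 2 ≤ i → 1 ≤ j → ⁅Tetrahedron.vecX F i, Tetrahedron.vecZ F j⁆ =
      Tetrahedron.vecX F (i + j + 1) - (2 : F) • Tetrahedron.vecZ F (i + j)
        - (16 : F) • Tetrahedron.vecX F (i + j - 1)
        + (32 : F) • Tetrahedron.vecZ F (i + j - 2)) ∧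
    -- brackets of the second family with the third
    (⁅Tetrahedron.vecY F 0, Tetrahedron.vecZ F 0⁆ =
      Tetrahedron.vecZ F 1 - Tetrahedron.vecY F 1) ∧
    (∀ i : ℕ, 1 ≤ i → ⁅Tetrahedron.vecY F i, Tetrahedron.vecZ F 0⁆ =
      Tetrahedron.vecZ F (i + 1) - Tetrahedron.vecY F (i + 1)
        + (4 : F) • Tetrahedron.vecZ F i - (4 : F) • Tetrahedron.vecY F i) ∧
    (∀ j : ℕ, 1 ≤ j → ⁅Tetrahedron.vecY F 0, Tetrahedron.vecZ F j⁆ =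
      Tetrahedron.vecZ F (j + 1) - Tetrahedron.vecY F (j + 1)
        - (4 : F) • Tetrahedron.vecZ F j + (4 : F) • Tetrahedron.vecY F j) ∧
    (∀ i j : ℕ, 1 ≤ i → 1 ≤ j → ⁅Tetrahedron.vecY F i, Tetrahedron.vecZ F j⁆ =
      Tetrahedron.vecZ F (i + j + 1) - Tetrahedron.vecY F (i + j + 1)
        - (16 : F) • Tetrahedron.vecZ F (i + j - 1)
        + (16 : F) • Tetrahedron.vecY F (i + j - 1)) := by
  refine ⟨⟨Tetrahedron.onsagerBasis F, fun i => Tetrahedron.onsagerBasis_apply F _,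
    fun i => Tetrahedron.onsagerBasis_apply F _, fun i => Tetrahedron.onsagerBasis_apply F _⟩,
    Tetrahedron.vecX_isLike F, Tetrahedron.vecY_isLike F, Tetrahedron.vecZ_isLike F, rfl,
    Tetrahedron.gen_zero_three_eq F, Tetrahedron.lie_vecX_self F, Tetrahedron.lie_vecY_self F,
    Tetrahedron.lie_vecZ_self F,
    Tetrahedron.lie_vecX_vecY_zero_zero F, Tetrahedron.lie_vecX_vecY_one_zero F, ?_, ?_, ?_,
    Tetrahedron.lie_vecX_vecZ_zero_zero F, Tetrahedron.lie_vecX_vecZ_one_zero F, ?_, ?_, ?_,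
    Tetrahedron.lie_vecY_vecZ_zero_zero F, ?_, ?_, ?_⟩
  -- In the remaining goals, indices are shifted by their lower bounds, so the truncated
  -- subtractions in the statement become exact.
  · intro i hi
    obtain ⟨i, rfl⟩ := Nat.exists_eq_add_of_le' hi
    exact Tetrahedron.lie_vecX_vecY_add_two_zero F i
  · intro i j hi hj
    obtain ⟨j, rfl⟩ := Nat.exists_eq_add_of_le' hj
    rcases Nat.le_one_iff_eq_zero_or_eq_one.1 hi with rfl | rfl
    · rw [zero_add]
      exact Tetrahedron.lie_vecX_vecY_zero_succ F j
    · rw [show 1 + (j + 1) = j + 2 by ring]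
      exact Tetrahedron.lie_vecX_vecY_one_succ F j
  · intro i j hi hj
    obtain ⟨i, rfl⟩ := Nat.exists_eq_add_of_le' hi
    obtain ⟨j, rfl⟩ := Nat.exists_eq_add_of_le' hj
    rw [show i + 2 + (j + 1) = i + j + 3 by ring]
    exact Tetrahedron.lie_vecX_vecY_add_two_succ F i j
  · intro i hi
    obtain ⟨i, rfl⟩ := Nat.exists_eq_add_of_le' hi
    exact Tetrahedron.lie_vecX_vecZ_add_two_zero F i
  · intro i j hi hj
    obtain ⟨j, rfl⟩ := Nat.exists_eq_add_of_le' hj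
    rcases Nat.le_one_iff_eq_zero_or_eq_one.1 hi with rfl | rfl
    · rw [zero_add]
      exact Tetrahedron.lie_vecX_vecZ_zero_succ F j
    · rw [show 1 + (j + 1) = j + 2 by ring]
      exact Tetrahedron.lie_vecX_vecZ_one_succ F j
  · intro i j hi hj
    obtain ⟨i, rfl⟩ := Nat.exists_eq_add_of_le' hi
    obtain ⟨j, rfl⟩ := Nat.exists_eq_add_of_le' hj
    rw [show i + 2 + (j + 1) = i + j + 3 by ring]
    exact Tetrahedron.lie_vecX_vecZ_add_two_succ F i j
  · intro i hi
    obtain ⟨i, rfl⟩ := Nat.exists_eq_add_of_le' hi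
    exact Tetrahedron.lie_vecY_vecZ_succ_zero F i
  · intro j hj
    obtain ⟨j, rfl⟩ := Nat.exists_eq_add_of_le' hj
    exact Tetrahedron.lie_vecY_vecZ_zero_succ F j
  · intro i j hi hj
    obtain ⟨i, rfl⟩ := Nat.exists_eq_add_of_le' hi
    obtain ⟨j, rfl⟩ := Nat.exists_eq_add_of_le' hj
    rw [show i + 1 + (j + 1) = i + j + 2 by ring]
    exact Tetrahedron.lie_vecY_vecZ_succ_succ F i j
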